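/- Let $d\ge 1$, let $\|\cdot\|$ be the Euclidean norm on $\mathbb R^d$, let $B^d=\{x\in\mathbb R^d:\|x\|\le 1\}$ and $S^{d-1}=\{x\in\mathbb R^d:\|x\|=1\}$, let $d\omega$ be the surface measure on $S^{d-1}$ (the counting measure if $d=1$) and let $\omega_d=\int_{S^{d-1}}d\omega$. Fix $\lambda>0$. On the space $\mathbb R[x_1,\dots,x_d]$ of real polynomials consider the inner product $$\langle f,g\rangle_{\mathrm I}=\frac{\lambda}{\omega_d}\int_{B^d}\nabla f(x)\cdot\nabla g(x)\,dx+\frac1{\omega_d}\int_{S^{d-1}}f(x)g(x)\,d\omega(x).$$ For $n\ge 0$ let $\mathcal V_n^d(\mathrm I)$ be the space of polynomials of total degree at most $n$ that are orthogonal with respect to $\langle\cdot,\cdot\rangle_{\mathrm I}$ to all polynomials of total degree less than $n$. For $k\ge0$ let $\mathcal H_k^d$ be the space of real homogeneous polynomials $Y$ of degree $k$ (together with $0$) satisfying $\Delta Y=0$, let $\sigma_k=\dim\mathcal H_k^d$, and let $\{Y_\nu^k:1\le\nu\le\sigma_k\}$ be a basis of $\mathcal H_k^d$ that is orthonormal in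 the sense that $\frac1{\omega_d}\int_{S^{d-1}}Y_\mu^kY_\nu^k\,d\omega=\delta_{\mu,\nu}$. Let $$P_m^{(\alpha,\beta)}(s)=\frac1{m!}\sum_{k=0}^m\binom mk(m+\alpha+\beta+1)_k(\alpha+k+1)_{m-k}\Bigl(\frac{s-1}2\Bigr)^k$$ be the Jacobi polynomials, where $(a)_k=a(a+1)\cdots(a+k-1)$. **Theorem.** For every $n\ge 0$, the polynomials $$U_{0,\nu}^n(x)=Y_\nu^n(x)\quad(1\le\nu\le\sigma_n),$$ $$U_{j,\nu}^n(x)=(1-\|x\|^2)\,P_{j-1}^{(1,\,n-2j+\frac{d-2}2)}(2\|x\|^2-1)\,Y_\nu^{n-2j}(x)\quad\Bigl(1\le j\le\frac n2,\ 1\le\nu\le\sigma_{n-2j}\Bigr)$$ form a basis of $\mathcal V_n^d(\mathrm I)$, and this basis is mutually orthogonal: $\langle U_{j,\nu}^n,U_{l,\mu}^n\rangle_{\mathrm I}=0$ whenever $(j,\nu)\ne(l,\mu)$. Moreover, $$\langle U_{0,\nu}^n,U_{0,\nu}^n\rangle_{\mathrm I}=\lambda n+1,\qquad \langle U_{j,\nu}^n,U_{j,\nu}^n\rangle_{\mathrm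 I}=\frac{2j^2\lambda}{n+\frac{d-2}2}\quad\Bigl(1\le j\le\frac n2\Bigr).$$ -/

import Mathlib

namespace BallSobolev

open MeasureTheory

/-- The ring `Π^d = ℝ[x₁, …, x_d]` of real polynomials in `d` variables. -/
abbrev Poly (d : ℕ) : Type := MvPolynomial (Fin d) ℝ

/-- The value of a polynomial at a point of Euclidean space. -/
noncomputable def val {d : ℕ} (f : Poly d) (x : EuclideanSpace ℝ (Fin d)) : ℝ :=
  MvPolynomial.eval (fun i => x i) f

/-- The surface measure `dω` on the unit sphere `S^{d-1}` of `ℝ^d`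
(for `d = 1` this is the counting measure on the two points `±1`). -/
noncomputable def surface (d : ℕ) :
    Measure (Metric.sphere (0 : EuclideanSpace ℝ (Fin d)) 1) :=
  (volume : Measure (EuclideanSpace ℝ (Fin d))).toSphere

/-- The surface area `ω_d` of the unit sphere `S^{d-1}`. -/
noncomputable def sphereArea (d : ℕ) : ℝ := ∫ _x, (1 : ℝ) ∂(surface d)

/-- The dot product `∇f(x) · ∇g(x)`. -/
noncomputable def gradDot {d : ℕ} (f g : Poly d) (x : EuclideanSpace ℝ (Fin d)) : ℝ :=
  ∑ i, val (MvPolynomial.pderiv i f) x * val (MvPolynomial.pderiv i g) x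

/-- The normalized `L²` inner product `(1/ω_d) ∫_{S^{d-1}} f g dω` on the sphere. -/
noncomputable def sphereInner {d : ℕ} (f g : Poly d) : ℝ :=
  1 / sphereArea d *
    ∫ x : Metric.sphere (0 : EuclideanSpace ℝ (Fin d)) 1, val f x * val g x ∂(surface d)

/-- The Sobolev inner product
`⟨f, g⟩_I = (lam/ω_d) ∫_{B^d} ∇f · ∇g dx + (1/ω_d) ∫_{S^{d-1}} f g dω`. -/
noncomputable def sobolevInner {d : ℕ} (lam : ℝ) (f g : Poly d) : ℝ :=
  lam / sphereArea d *
      (∫ x in Metric.closedBall (0 : EuclideanSpace ℝ (Fin d)) 1, gradDot f g x)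
    + sphereInner f g

/-! Linearity of the inner product in its first argument, needed to know that the
orthogonal polynomials of degree `n` form a vector space. -/

theorem continuous_val {d : ℕ} (f : Poly d) : Continuous (val f) := by
  unfold val
  exact (MvPolynomial.continuous_eval f).comp (by fun_prop)

theorem continuous_gradDot {d : ℕ} (f g : Poly d) : Continuous (gradDot f g) := by
  unfold gradDot
  exact continuous_finsetSum _ fun i _ => (continuous_val _).mul (continuous_val _)

instance (d : ℕ) : IsFiniteMeasure (surface d) := by
  unfold surface; infer_instance

theorem integrable_sphere {d : ℕ} (f g : Poly d) :
    Integrable (fun x : Metric.sphere (0 : EuclideanSpace ℝ (Fin d)) 1 =>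
      val f x * val g x) (surface d) := by
  have hc : Continuous (fun x : Metric.sphere (0 : EuclideanSpace ℝ (Fin d)) 1 =>
      val f x * val g x) :=
    ((continuous_val f).comp continuous_subtype_val).mul
      ((continuous_val g).comp continuous_subtype_val)
  exact hc.integrable_of_hasCompactSupport (HasCompactSupport.of_compactSpace _)

theorem integrableOn_ball {d : ℕ} (f g : Poly d) :
    IntegrableOn (gradDot f g) (Metric.closedBall (0 : EuclideanSpace ℝ (Fin d)) 1) :=
  (continuous_gradDot f g).continuousOn.integrableOn_compact (isCompact_closedBall _ _)

theorem sobolevInner_add_left {d : ℕ} (lam : ℝ) (f g h : Poly d) :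
    sobolevInner lam (f + g) h = sobolevInner lam f h + sobolevInner lam g h := by
  have h1 : gradDot (f + g) h = fun x => gradDot f h x + gradDot g h x := by
    funext x
    simp [gradDot, val, add_mul, Finset.sum_add_distrib]
  have h2 : ∀ x : Metric.sphere (0 : EuclideanSpace ℝ (Fin d)) 1,
      val (f + g) x * val h x = val f x * val h x + val g x * val h x := fun x => by
    simp [val, add_mul]
  unfold sobolevInner sphereInner
  simp only [h1, h2]
  rw [integral_add (integrableOn_ball f h) (integrableOn_ball g h),
    integral_add (integrable_sphere f h) (integrable_sphere g h)]
  ring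

theorem sobolevInner_smul_left {d : ℕ} (lam c : ℝ) (f h : Poly d) :
    sobolevInner lam (c • f) h = c * sobolevInner lam f h := by
  have h1 : gradDot (c • f) h = fun x => c * gradDot f h x := by
    funext x
    simp [gradDot, val, mul_assoc, Finset.mul_sum]
  have h2 : ∀ x : Metric.sphere (0 : EuclideanSpace ℝ (Fin d)) 1,
      val (c • f) x * val h x = c * (val f x * val h x) := fun x => by
    simp [val, mul_assoc]
  unfold sobolevInner sphereInner
  simp only [h1, h2]
  rw [integral_const_mul, integral_const_mul]
  ring

/-- The space `𝒱_n^d(I)` of Sobolev orthogonal polynomials of degree `n`: the polynomials of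
total degree at most `n` that are orthogonal to all polynomials of degree less than `n`. -/
noncomputable def orthoPoly (d : ℕ) (lam : ℝ) (n : ℕ) : Submodule ℝ (Poly d) where
  carrier := {P | P.totalDegree ≤ n ∧
    ∀ Q : Poly d, Q.totalDegree < n → sobolevInner lam P Q = 0}
  zero_mem' := ⟨by simp, fun Q _ => by
    simpa using sobolevInner_smul_left lam 0 (0 : Poly d) Q⟩
  add_mem' := fun {P R} hP hR =>
    ⟨(MvPolynomial.totalDegree_add P R).trans (max_le hP.1 hR.1), fun Q hQ => by
      rw [sobolevInner_add_left, hP.2 Q hQ, hR.2 Q hQ, add_zero]⟩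
  smul_mem' := fun c P hP =>
    ⟨(MvPolynomial.totalDegree_smul_le c P).trans hP.1, fun Q hQ => by
      rw [sobolevInner_smul_left, hP.2 Q hQ, mul_zero]⟩

/-- The Laplace operator on polynomials. -/
noncomputable def laplacian (d : ℕ) : Poly d →ₗ[ℝ] Poly d :=
  ∑ i, (MvPolynomial.pderiv i).toLinearMap ∘ₗ (MvPolynomial.pderiv i).toLinearMap

/-- The space `ℋ_n^d` of homogeneous harmonic polynomials of degree `n`. -/
noncomputable def harmonics (d n : ℕ) : Submodule ℝ (Poly d) :=
  MvPolynomial.homogeneousSubmodule (Fin d) ℝ n ⊓ LinearMap.ker (laplacian d)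

/-- `σ_n = dim ℋ_n^d`. -/
noncomputable def harmonicDim (d n : ℕ) : ℕ := Module.finrank ℝ (harmonics d n)

/-- `Y` is an orthonormal basis of `ℋ_n^d` with respect to the normalized `L²` inner product on
the sphere. -/
structure IsOrthonormalHarmonicBasis (d n : ℕ) (Y : Fin (harmonicDim d n) → Poly d) :
    Prop where
  linearIndependent : LinearIndependent ℝ Y
  span_eq : Submodule.span ℝ (Set.range Y) = harmonics d n
  orthonormal : ∀ μ ν, sphereInner (Y μ) (Y ν) = if μ = ν then 1 else 0

/-- The Jacobi polynomial in its usual normalization,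
`P_m^{(α,β)}(s) = (1/m!) ∑_{k=0}^m C(m,k) (m+α+β+1)_k (α+k+1)_{m-k} ((s-1)/2)^k`,
where `(a)_k = a(a+1)⋯(a+k-1)`. -/
noncomputable def jacobi (α β : ℝ) (m : ℕ) : Polynomial ℝ :=
  ∑ k ∈ Finset.range (m + 1),
    Polynomial.C ((m.choose k : ℝ) / (m.factorial : ℝ)
        * (ascPochhammer ℝ k).eval ((m : ℝ) + α + β + 1)
        * (ascPochhammer ℝ (m - k)).eval (α + (k : ℝ) + 1))
      * (Polynomial.C (1 / 2 : ℝ) * (Polynomial.X - 1)) ^ k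

/-- The polynomial `‖x‖² = x₁² + ⋯ + x_d²`. -/
noncomputable def normSq (d : ℕ) : Poly d := ∑ i, MvPolynomial.X i ^ 2

/-- The polynomial `U_j^n` attached to `Y ∈ ℋ_{n-2j}^d`: it is `Y` for `j = 0`, and
`(1 - ‖x‖²) P_{j-1}^{(1, n-2j+(d-2)/2)}(2‖x‖² - 1) Y(x)` for `1 ≤ j ≤ n/2`. -/
noncomputable def sobolevU (d n j : ℕ) (Y : Poly d) : Poly d :=
  if j = 0 then Y
  else (1 - normSq d)
    * Polynomial.aeval (2 * normSq d - 1)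
        (jacobi 1 ((n : ℝ) - 2 * (j : ℝ) + ((d : ℝ) - 2) / 2) (j - 1))
    * Y

end BallSobolev

namespace BallSobolev

open MeasureTheory

/-! Everything rests on Green's identity `ballMean_green`, in which the normal derivative on the
sphere is the Euler operator. With a harmonic `Y` of degree `n` as second factor, the Sobolev
product collapses to `lam * n + 1` times the spherical one. With a first factor `bubble` that
vanishes on the sphere, only `-lam` times the ball integral of `bubble * Δf` survives.

On products `g(‖x‖²) Y` with `Y` harmonic of degree `k`, the Laplacian acts as `4 (t g'' + (b+1)
g')`, where `b = k + (d-2)/2`. The Jacobi equation says that this sends `(1-t) P_m^{(1,b)}(2t-1)` to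
a multiple of `P_m^{(1,b)}(2t-1)` (`jacobiUnit_ode`). Orthogonality and norms thus become
one-variable statements about the weight `(1-t) t^b` on `[0,1]`, and both follow from the
differential equation by integration by parts.

For completeness, `fischerSpan` shows that the products `‖x‖^{2i} H` with `H` harmonic span all
polynomials, and the radial factors `1, (1-t)p_0, (1-t)p_1, …` have degrees `0, 1, 2, …`, so they
span `ℝ[t]`. The family over all degrees is therefore an orthogonal basis of the whole polynomial
ring. Reading off coefficients identifies `orthoPoly` with the span of the members of degree `n`,
with no dimension count.

The divergence theorem on the ball is itself derived from integration by parts against a Gaussian on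
the whole space, which has no boundary. -/

/-! ### Polar coordinates and Gaussian integrals of homogeneous polynomials -/

theorem val_smul_of_isHomogeneous {d e : ℕ} {F : Poly d} (hF : F.IsHomogeneous e) (r : ℝ)
    (x : EuclideanSpace ℝ (Fin d)) : val F (r • x) = r ^ e * val F x := by
  unfold val
  simp only [MvPolynomial.eval_eq, Finset.mul_sum]
  refine Finset.sum_congr rfl fun s hs => ?_
  have hd := hF.degree_eq_sum_deg_support hs
  simp only [PiLp.smul_apply, smul_eq_mul, mul_pow, Finset.prod_mul_distrib,
    Finset.prod_pow_eq_pow_sum]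
  have : ∑ i ∈ s.support, s i = e := by
    exact hd.symm
  rw [this]; ring

theorem hasFDerivAt_val {d : ℕ} (F : Poly d) (x : EuclideanSpace ℝ (Fin d)) :
    HasFDerivAt (val F) (∑ i, val (MvPolynomial.pderiv i F) x •
      (EuclideanSpace.proj i : EuclideanSpace ℝ (Fin d) →L[ℝ] ℝ)) x := by
  induction F using MvPolynomial.induction_on with
  | C a =>
    have : val (MvPolynomial.C a : Poly d) = fun _ => a := by funext y; simp [val]
    rw [this]
    simpa [val] using hasFDerivAt_const a x
  | add p q hp hq =>
    have h := hp.add hq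
    have e : val (p + q) = val p + val q := by funext y; simp [val]
    rw [e]
    refine h.congr_fderiv ?_
    simp [val, add_smul, Finset.sum_add_distrib]
  | mul_X p j hp =>
    have e : val (p * MvPolynomial.X j) = fun y => val p y * y j := by funext y; simp [val]
    rw [e]
    have hj : HasFDerivAt (fun y : EuclideanSpace ℝ (Fin d) => y j)
      (EuclideanSpace.proj j : EuclideanSpace ℝ (Fin d) →L[ℝ] ℝ) x :=
      (EuclideanSpace.proj j : EuclideanSpace ℝ (Fin d) →L[ℝ] ℝ).hasFDerivAt
    refine (hp.mul hj).congr_fderiv ?_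
    ext v
    have h1 : ∀ i, val (MvPolynomial.pderiv i (p * MvPolynomial.X j)) x =
        (if i = j then val p x else 0) + x j * val (MvPolynomial.pderiv i p) x := fun i => by
      by_cases hij : i = j
      · subst hij; simp [val]
      · simp [val, MvPolynomial.pderiv_X_of_ne (Ne.symm hij), hij]
    simp only [h1]
    simp [add_mul, Finset.sum_add_distrib, Finset.mul_sum, mul_assoc]

/-- Polar coordinates for a homogeneous polynomial times a radial function. -/
theorem integral_val_mul_radial {d e : ℕ} [Nonempty (Fin d)] {F : Poly d}
    (hF : F.IsHomogeneous e) (φ : ℝ → ℝ) :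
    ∫ x : EuclideanSpace ℝ (Fin d), val F x * φ ‖x‖ =
      (∫ x, val F (x : EuclideanSpace ℝ (Fin d)) ∂(surface d)) *
        ∫ r in Set.Ioi (0 : ℝ), r ^ (d - 1) * (r ^ e * φ r) := by
  calc ∫ x : EuclideanSpace ℝ (Fin d), val F x * φ ‖x‖
      = ∫ x : ({(0)}ᶜ : Set (EuclideanSpace ℝ (Fin d))), val F x.1 * φ (‖x.1‖)
          ∂((volume : Measure (EuclideanSpace ℝ (Fin d))).comap (↑)) := by
        rw [integral_subtype_comap (measurableSet_singleton _).compl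
          fun x => val F x * φ (‖x‖), restrict_compl_singleton]
    _ = ∫ x, val F x.1 * ((x.2 : ℝ) ^ e * φ x.2)
          ∂(surface d).prod (.volumeIoiPow (d - 1)) := by
        have := (volume : Measure (EuclideanSpace ℝ (Fin d))).measurePreserving_homeomorphUnitSphereProd.integral_comp
          (Homeomorph.measurableEmbedding _)
          (fun z : Metric.sphere (0 : EuclideanSpace ℝ (Fin d)) 1 × Set.Ioi (0 : ℝ) =>
            val F z.1 * ((z.2 : ℝ) ^ e * φ z.2))
        rw [finrank_euclideanSpace_fin] at this
        unfold surface
        rw [← this]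
        refine integral_congr_ae (.of_forall fun x => ?_)
        have hx : ‖x.1‖ ≠ 0 := norm_ne_zero_iff.2 x.2
        simp only [homeomorphUnitSphereProd_apply_snd_coe, homeomorphUnitSphereProd_apply_fst_coe]
        rw [val_smul_of_isHomogeneous hF, ← mul_assoc, mul_right_comm (_ ^ e), ← mul_pow,
          inv_mul_cancel₀ hx, one_pow, one_mul]
    _ = (∫ x, val F (x : EuclideanSpace ℝ (Fin d)) ∂(surface d)) *
          ∫ r : Set.Ioi (0 : ℝ), ((r : ℝ) ^ e * φ r) ∂(.volumeIoiPow (d - 1)) :=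
        integral_prod_mul (fun x : Metric.sphere (0 : EuclideanSpace ℝ (Fin d)) 1 => val F x)
          (fun r : Set.Ioi (0 : ℝ) => ((r : ℝ) ^ e * φ r))
    _ = _ := by
        congr 1
        simp only [Measure.volumeIoiPow, ENNReal.ofReal]
        rw [integral_withDensity_eq_integral_smul,
          integral_subtype_comap measurableSet_Ioi fun a =>
            Real.toNNReal (a ^ (d - 1)) • (a ^ e * φ a),
          setIntegral_congr_fun measurableSet_Ioi fun x hx => ?_]
        · rw [NNReal.smul_def, Real.coe_toNNReal _ (pow_nonneg (le_of_lt hx) _), smul_eq_mul]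
        · exact (measurable_subtype_coe.pow_const _).real_toNNReal

/-- Compactness of the sphere and homogeneity give `|F x| ≤ C ‖x‖^e`, leaving a radial integral. -/
theorem integrable_val_mul_gaussian {d e : ℕ} [Nonempty (Fin d)] {F : Poly d}
    (hF : F.IsHomogeneous e) :
    Integrable fun x : EuclideanSpace ℝ (Fin d) => val F x * Real.exp (-‖x‖ ^ 2) := by
  obtain ⟨C, hC⟩ := (isCompact_sphere (0 : EuclideanSpace ℝ (Fin d)) 1).exists_bound_of_continuousOn
    (continuous_val F).continuousOn
  have hb : ∀ x, ‖val F x‖ ≤ C * ‖x‖ ^ e := by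
    intro x
    by_cases hx : x = 0
    -- Writing the origin as `0 • y` with `‖y‖ = 1` also covers `e = 0`, where `0 ^ 0 = 1`.
    · obtain ⟨y, hy⟩ := (NormedSpace.sphere_nonempty (x := (0 : EuclideanSpace ℝ (Fin d)))
        (r := 1)).2 zero_le_one
      have h0 := hC y hy
      have := val_smul_of_isHomogeneous hF 0 y
      rw [zero_smul] at this
      rw [hx, this, norm_mul, norm_zero, norm_pow, norm_zero, mul_comm]
      exact mul_le_mul_of_nonneg_right h0 (by positivity)
    · have hx' : ‖x‖ ≠ 0 := by simpa using hx
      have := val_smul_of_isHomogeneous hF ‖x‖ (‖x‖⁻¹ • x)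
      rw [smul_inv_smul₀ hx'] at this
      rw [this, norm_mul, norm_pow, norm_norm, mul_comm]
      exact mul_le_mul_of_nonneg_right (hC _ (by simp [norm_smul, hx'])) (by positivity)
  have hg : Integrable fun x : EuclideanSpace ℝ (Fin d) =>
      C * (‖x‖ ^ e * Real.exp (-‖x‖ ^ 2)) := by
    refine Integrable.const_mul ?_ C
    refine (integrable_fun_norm_addHaar (volume : Measure (EuclideanSpace ℝ (Fin d)))
      (f := fun r => r ^ e * Real.exp (-r ^ 2))).2 ?_
    rw [finrank_euclideanSpace_fin]
    have := integrableOn_rpow_mul_exp_neg_mul_sq (b := 1) one_pos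
      (s := ((d - 1 + e : ℕ) : ℝ)) (by linarith [(Nat.cast_nonneg (d - 1 + e) : (0:ℝ) ≤ _)])
    refine this.congr_fun (fun r _ => ?_) measurableSet_Ioi
    simp only [Real.rpow_natCast, smul_eq_mul, pow_add]
    ring_nf
  refine hg.mono' ((continuous_val F).mul (by fun_prop)).aestronglyMeasurable
    (.of_forall fun x => ?_)
  rw [norm_mul, Real.norm_of_nonneg (Real.exp_pos _).le, ← mul_assoc]
  exact mul_le_mul_of_nonneg_right (hb x) (Real.exp_pos _).le

theorem integral_pow_mul_gaussian (a : ℕ) :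
    ∫ r in Set.Ioi (0 : ℝ), r ^ a * Real.exp (-r ^ 2) = 1 / 2 * Real.Gamma ((a + 1) / 2) := by
  have := integral_rpow_mul_exp_neg_rpow (p := 2) (q := (a : ℝ)) two_pos
    (by linarith [(Nat.cast_nonneg a : (0:ℝ) ≤ _)])
  rw [← this]
  refine setIntegral_congr_fun measurableSet_Ioi fun x hx => ?_
  simp

theorem integral_val_mul_gaussian {d e : ℕ} [Nonempty (Fin d)] {F : Poly d}
    (hF : F.IsHomogeneous e) :
    ∫ x : EuclideanSpace ℝ (Fin d), val F x * Real.exp (-‖x‖ ^ 2) =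
      (∫ x, val F (x : EuclideanSpace ℝ (Fin d)) ∂(surface d)) *
        (1 / 2 * Real.Gamma ((d + e : ℝ) / 2)) := by
  have hd : 1 ≤ d := Fin.pos_iff_nonempty.2 ‹_›
  rw [integral_val_mul_radial hF (fun r => Real.exp (-r ^ 2))]
  simp only [← mul_assoc, ← pow_add]
  rw [integral_pow_mul_gaussian]
  push_cast [hd]
  ring_nf

/-- Integration by parts on the whole space; differentiating the Gaussian brings down `-2 xᵢ`. -/
theorem integral_pderiv_mul_gaussian {d e : ℕ} [Nonempty (Fin d)] {F : Poly d}
    (hF : F.IsHomogeneous e) (i : Fin d) :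
    ∫ x : EuclideanSpace ℝ (Fin d), val (MvPolynomial.pderiv i F) x * Real.exp (-‖x‖ ^ 2) =
      2 * ∫ x : EuclideanSpace ℝ (Fin d),
        val (MvPolynomial.X i * F) x * Real.exp (-‖x‖ ^ 2) := by
  have h1 : ∀ x, fderiv ℝ (val F) x (EuclideanSpace.single i 1) =
      val (MvPolynomial.pderiv i F) x := fun x => by
    rw [(hasFDerivAt_val F x).fderiv]
    simp [PiLp.single_apply]
  have hg : ∀ x : EuclideanSpace ℝ (Fin d), HasFDerivAt (fun x : EuclideanSpace ℝ (Fin d) => Real.exp (-‖x‖ ^ 2))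
      (Real.exp (-‖x‖ ^ 2) • 
        -(2 • innerSL ℝ x : EuclideanSpace ℝ (Fin d) →L[ℝ] ℝ)) x := fun x =>
    ((hasStrictFDerivAt_norm_sq x).hasFDerivAt.neg).exp
  have h2 : ∀ x, fderiv ℝ (fun x : EuclideanSpace ℝ (Fin d) => Real.exp (-‖x‖ ^ 2)) x
      (EuclideanSpace.single i 1) = -2 * (x i * Real.exp (-‖x‖ ^ 2)) := fun x => by
    rw [(hg x).fderiv]
    simp [EuclideanSpace.inner_single_right]
    ring
  have hX : (MvPolynomial.X i * F).IsHomogeneous (1 + e) :=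
    (MvPolynomial.isHomogeneous_X ℝ i).mul hF
  have h3 : ∀ x : EuclideanSpace ℝ (Fin d), val F x * (-2 * (x i * Real.exp (-‖x‖ ^ 2))) =
      -2 * (val (MvPolynomial.X i * F) x * Real.exp (-‖x‖ ^ 2)) := fun x => by
    simp [val]; ring
  have := integral_mul_fderiv_eq_neg_fderiv_mul_of_integrable
    (μ := (volume : Measure (EuclideanSpace ℝ (Fin d)))) (𝕜 := ℝ)
    (f := val F) (g := fun x : EuclideanSpace ℝ (Fin d) => Real.exp (-‖x‖ ^ 2))
    (v := EuclideanSpace.single i 1)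
    (by simp only [h1]; exact integrable_val_mul_gaussian (hF.pderiv))
    (by simp only [h2, h3]; exact (integrable_val_mul_gaussian hX).const_mul _)
    (integrable_val_mul_gaussian hF)
    (fun x _ => (hasFDerivAt_val F x).differentiableAt)
    (fun x _ => (hg x).differentiableAt)
  simp only [h1, h2, h3, integral_const_mul] at this
  linarith

/-! ### Normalized means and the divergence theorem -/

/-- The normalized integral of a polynomial over the unit sphere. -/
noncomputable def sphereMean (d : ℕ) : Poly d →ₗ[ℝ] ℝ where
  toFun F := 1 / sphereArea d *
    ∫ x : Metric.sphere (0 : EuclideanSpace ℝ (Fin d)) 1, val F x ∂(surface d)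
  map_add' F G := by
    have h : ∀ H : Poly d, Integrable (fun x : Metric.sphere (0 : EuclideanSpace ℝ (Fin d)) 1 =>
        val H x) (surface d) := fun H =>
      ((continuous_val H).comp continuous_subtype_val).integrable_of_hasCompactSupport
        (HasCompactSupport.of_compactSpace _)
    have e : ∀ x, val (F + G) x = val F x + val G x := fun x => by simp [val]
    simp only [e]
    rw [integral_add (h F) (h G), mul_add]
  map_smul' c F := by
    have e : ∀ x, val (c • F) x = c * val F x := fun x => by simp [val]
    simp only [e, integral_const_mul, RingHom.id_apply, smul_eq_mul]
    ring

/-- The integral of a polynomial over the unit ball, divided by the area of the unit sphere. -/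
noncomputable def ballMean (d : ℕ) : Poly d →ₗ[ℝ] ℝ where
  toFun F := 1 / sphereArea d *
    ∫ x in Metric.closedBall (0 : EuclideanSpace ℝ (Fin d)) 1, val F x
  map_add' F G := by
    have h : ∀ H : Poly d, IntegrableOn (val H)
        (Metric.closedBall (0 : EuclideanSpace ℝ (Fin d)) 1) := fun H =>
      (continuous_val H).continuousOn.integrableOn_compact (isCompact_closedBall _ _)
    have e : ∀ x, val (F + G) x = val F x + val G x := fun x => by simp [val]
    simp only [e]
    rw [integral_add (h F) (h G), mul_add]
  map_smul' c F := by
    have e : ∀ x, val (c • F) x = c * val F x := fun x => by simp [val]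
    simp only [e, integral_const_mul, RingHom.id_apply, smul_eq_mul]
    ring

theorem sphereInner_eq {d : ℕ} (f g : Poly d) : sphereInner f g = sphereMean d (f * g) := by
  simp [sphereInner, sphereMean, val]

theorem sobolevInner_eq {d : ℕ} (lam : ℝ) (f g : Poly d) :
    sobolevInner lam f g =
      lam * ballMean d (∑ i, MvPolynomial.pderiv i f * MvPolynomial.pderiv i g) +
        sphereMean d (f * g) := by
  have h : ∀ x, gradDot f g x =
      val (∑ i, MvPolynomial.pderiv i f * MvPolynomial.pderiv i g) x := fun x => by
    simp [gradDot, val]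
  simp only [sobolevInner, sphereInner_eq, h]
  simp only [ballMean, LinearMap.coe_mk, AddHom.coe_mk]
  ring

theorem sphereMean_normSq_mul {d : ℕ} (F : Poly d) :
    sphereMean d (normSq d * F) = sphereMean d F := by
  simp only [sphereMean, LinearMap.coe_mk, AddHom.coe_mk]
  congr 2
  funext x
  have hx : ∑ i, (x : EuclideanSpace ℝ (Fin d)) i ^ 2 = 1 := by
    rw [← EuclideanSpace.real_norm_sq_eq]
    simp
  simp [val, normSq, hx]

theorem ballMean_of_isHomogeneous {d e : ℕ} (hd : 1 ≤ d) {F : Poly d} (hF : F.IsHomogeneous e) :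
    ballMean d F = sphereMean d F / (e + d) := by
  have : Nonempty (Fin d) := Fin.pos_iff_nonempty.1 hd
  have h := integral_val_mul_radial hF ((Set.Iic (1 : ℝ)).indicator fun _ => 1)
  have h1 : ∀ x : EuclideanSpace ℝ (Fin d),
      val F x * (Set.Iic (1 : ℝ)).indicator (fun _ => 1) ‖x‖ =
        (Metric.closedBall (0 : EuclideanSpace ℝ (Fin d)) 1).indicator (val F) x := fun x => by
    by_cases hx : ‖x‖ ≤ 1
    · rw [Set.indicator_of_mem (Set.mem_Iic.2 hx),
        Set.indicator_of_mem (mem_closedBall_zero_iff.2 hx), mul_one]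
    · rw [Set.indicator_of_notMem (by simpa using hx),
        Set.indicator_of_notMem (by simpa using hx), mul_zero]
  have h2 : ∫ r in Set.Ioi (0 : ℝ), r ^ (d - 1) *
      (r ^ e * (Set.Iic (1 : ℝ)).indicator (fun _ => 1) r) = 1 / (e + d) := by
    have h3 : ∀ r : ℝ, r ^ (d - 1) * (r ^ e * (Set.Iic (1 : ℝ)).indicator (fun _ => 1) r) =
        (Set.Iic (1 : ℝ)).indicator (fun r => r ^ (d - 1 + e)) r := fun r => by
      by_cases hr : r ≤ 1 <;> simp [hr, pow_add]
    simp only [h3]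
    rw [setIntegral_indicator measurableSet_Iic, Set.Ioi_inter_Iic,
      ← intervalIntegral.integral_of_le zero_le_one, integral_pow]
    push_cast [hd]
    simp
    ring
  simp only [h1, h2, integral_indicator Metric.isClosed_closedBall.measurableSet] at h
  simp only [sphereMean, ballMean, LinearMap.coe_mk, AddHom.coe_mk, h]
  ring

/-- In polar coordinates the two sides of the Gaussian identity have degrees `e` and `e + 2`; the
ratio of their radial factors is given by `Γ(s+1) = s Γ(s)` at `s = (d+e)/2`. -/
theorem sphereMean_pderiv {d e : ℕ} (hd : 1 ≤ d) {F : Poly d} (hF : F.IsHomogeneous (e + 1))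
    (i : Fin d) :
    sphereMean d (MvPolynomial.pderiv i F) = (e + d) * sphereMean d (MvPolynomial.X i * F) := by
  have : Nonempty (Fin d) := Fin.pos_iff_nonempty.1 hd
  have h := integral_pderiv_mul_gaussian hF i
  have hd' : MvPolynomial.IsHomogeneous (MvPolynomial.pderiv i F) e := hF.pderiv
  have hX : (MvPolynomial.X i * F).IsHomogeneous (1 + (e + 1)) :=
    (MvPolynomial.isHomogeneous_X ℝ i).mul hF
  rw [integral_val_mul_gaussian hd', integral_val_mul_gaussian hX] at h
  have hpos : (0 : ℝ) < ((d : ℝ) + e) / 2 := by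
    have : (0 : ℝ) < d := by exact_mod_cast hd
    positivity
  have hG : Real.Gamma (((d : ℝ) + (1 + (e + 1) : ℕ)) / 2) =
      ((d : ℝ) + e) / 2 * Real.Gamma (((d : ℝ) + e) / 2) := by
    rw [← Real.Gamma_add_one hpos.ne']
    push_cast
    ring_nf
  rw [hG] at h
  have hne := (Real.Gamma_pos_of_pos hpos).ne'
  simp only [sphereMean, LinearMap.coe_mk, AddHom.coe_mk]
  have h' : (∫ x, val (MvPolynomial.pderiv i F) (x : EuclideanSpace ℝ (Fin d)) ∂(surface d)) =
      (e + d) * ∫ x, val (MvPolynomial.X i * F) (x : EuclideanSpace ℝ (Fin d)) ∂(surface d) := by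
    apply mul_right_cancel₀ hne
    linarith
  rw [h']
  ring

/-- The divergence theorem on the unit ball. -/
theorem ballMean_pderiv {d : ℕ} (hd : 1 ≤ d) (F : Poly d) (i : Fin d) :
    ballMean d (MvPolynomial.pderiv i F) = sphereMean d (MvPolynomial.X i * F) := by
  have : Nonempty (Fin d) := Fin.pos_iff_nonempty.1 hd
  have key : ∀ e (G : Poly d), G.IsHomogeneous e →
      ballMean d (MvPolynomial.pderiv i G) = sphereMean d (MvPolynomial.X i * G) := by
    intro e G hG
    have hdpos : (0 : ℝ) < d := by exact_mod_cast hd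
    -- For a constant the left side is zero, and the Gaussian identity forces the mean of `c xᵢ` to
    -- vanish too. In positive degree, the factor `e + d` cancels the radial integral over the ball.
    rcases e with _ | e
    · obtain ⟨c, rfl⟩ : ∃ c, G = MvPolynomial.C c :=
        ⟨_, MvPolynomial.totalDegree_eq_zero_iff_eq_C.1
          ((MvPolynomial.totalDegree_zero_iff_isHomogeneous _).2 hG)⟩
      have h := integral_pderiv_mul_gaussian hG i
      have hX : (MvPolynomial.X i * (MvPolynomial.C c : Poly d)).IsHomogeneous (1 + 0) :=
        (MvPolynomial.isHomogeneous_X ℝ i).mul hG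
      rw [integral_val_mul_gaussian hX] at h
      have hne := (Real.Gamma_pos_of_pos
        (by positivity : (0 : ℝ) < ((d : ℝ) + (1 + 0 : ℕ)) / 2)).ne'
      have h0 : ∫ x, val (MvPolynomial.X i * (MvPolynomial.C c : Poly d))
          (x : EuclideanSpace ℝ (Fin d)) ∂(surface d) = 0 := by
        have : ∀ x, val (0 : Poly d) x = 0 := fun x => by simp [val]
        simp only [MvPolynomial.pderiv_C, this, zero_mul, integral_zero] at h
        have h' := h.symm
        simpa only [mul_eq_zero, two_ne_zero, hne, or_false, false_or, one_div, inv_eq_zero] using h'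
      rw [MvPolynomial.pderiv_C, map_zero]
      simp only [sphereMean, LinearMap.coe_mk, AddHom.coe_mk, h0, mul_zero]
    · rw [ballMean_of_isHomogeneous hd (e := e) hG.pderiv, sphereMean_pderiv hd hG]
      field_simp
  conv_lhs => rw [← MvPolynomial.sum_homogeneousComponent F]
  conv_rhs => rw [← MvPolynomial.sum_homogeneousComponent F]
  simp only [map_sum, Finset.mul_sum]
  exact Finset.sum_congr rfl fun e _ =>
    key e _ (MvPolynomial.homogeneousComponent_isHomogeneous e F)

/-! ### One-variable moments and the radial operator -/

/-- The functional `q ↦ ∫₀¹ q(t) t^b dt` on polynomials. -/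
noncomputable def powerMoment (b : ℝ) : Polynomial ℝ →ₗ[ℝ] ℝ :=
  Polynomial.lsum fun i => (1 / ((i : ℝ) + b + 1)) • LinearMap.id

theorem powerMoment_monomial (b : ℝ) (i : ℕ) (a : ℝ) :
    powerMoment b (Polynomial.monomial i a) = a / ((i : ℝ) + b + 1) := by
  simp [powerMoment, Polynomial.lsum_apply, Polynomial.sum_monomial_index]
  ring

theorem powerMoment_C_mul (b c : ℝ) (q : Polynomial ℝ) :
    powerMoment b (Polynomial.C c * q) = c * powerMoment b q := by
  rw [← Polynomial.smul_eq_C_mul, map_smul, smul_eq_mul]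

/-- The fundamental theorem of calculus for `t^(b+1) q(t)` on `[0, 1]`. -/
theorem powerMoment_X_mul_derivative {b : ℝ} (hb : -1 < b) (q : Polynomial ℝ) :
    powerMoment b (Polynomial.X * Polynomial.derivative q + Polynomial.C (b + 1) * q) =
      q.eval 1 := by
  induction q using Polynomial.induction_on' with
  | add p q hp hq =>
    rw [Polynomial.eval_add, ← hp, ← hq, ← map_add, Polynomial.derivative_add]
    congr 1
    ring
  | monomial n a =>
    have h : Polynomial.X * Polynomial.derivative (Polynomial.monomial n a) +
        Polynomial.C (b + 1) * Polynomial.monomial n a =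
        Polynomial.monomial n (a * (n + b + 1)) := by
      rcases n with _ | n
      · simp [mul_comm]
      · rw [Polynomial.derivative_monomial_succ, Polynomial.X_mul_monomial,
          Polynomial.C_mul_monomial, ← map_add]
        congr 1
        push_cast
        ring
    have hne : (n : ℝ) + b + 1 ≠ 0 := by
      have : (0 : ℝ) ≤ n := n.cast_nonneg
      linarith
    rw [h, powerMoment_monomial, Polynomial.eval_monomial, one_pow, mul_one]
    field_simp

/-- The differential operator `f ↦ t f'' + (b + 1) f'`. -/
noncomputable def radialLaplacian (b : ℝ) (f : Polynomial ℝ) : Polynomial ℝ :=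
  Polynomial.X * Polynomial.derivative (Polynomial.derivative f) +
    Polynomial.C (b + 1) * Polynomial.derivative f

/-- Integration by parts, since the operator is `t^{-b} (t^{b+1} f')'`: apply
`powerMoment_X_mul_derivative` to `f' g`. -/
theorem powerMoment_radialLaplacian_mul {b : ℝ} (hb : -1 < b) (f g : Polynomial ℝ) :
    powerMoment b (radialLaplacian b f * g) =
      (Polynomial.derivative f).eval 1 * g.eval 1 -
        powerMoment b (Polynomial.X * Polynomial.derivative f * Polynomial.derivative g) := by
  rw [eq_sub_iff_add_eq, ← map_add, ← Polynomial.eval_mul,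
    ← powerMoment_X_mul_derivative hb, Polynomial.derivative_mul, radialLaplacian]
  congr 1
  ring

theorem powerMoment_radialLaplacian_comm {b : ℝ} (hb : -1 < b) {f g : Polynomial ℝ}
    (hf : f.eval 1 = 0) (hg : g.eval 1 = 0) :
    powerMoment b (radialLaplacian b f * g) = powerMoment b (radialLaplacian b g * f) := by
  rw [powerMoment_radialLaplacian_mul hb, powerMoment_radialLaplacian_mul hb, hf, hg,
    mul_right_comm]
  simp

section Eigenfunction

variable {b : ℝ} {m : ℕ} {p : Polynomial ℝ}

/-- By symmetry the operator moves onto `(1-t) t^i`, giving `i(i+b) t^{i-1} - (i+1)(i+1+b) t^i`.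
Induction kills the first term, and the second has a coefficient different from that of the
eigenfunction because `i < m`. -/
theorem powerMoment_eigenfunction_mul_X_pow (hb : -1 < b)
    (hode : radialLaplacian b ((1 - Polynomial.X) * p) =
      Polynomial.C (-(((m : ℝ) + 1) * (m + 1 + b))) * p) (i : ℕ) (hi : i < m) :
    powerMoment b ((1 - Polynomial.X) * p * Polynomial.X ^ i) = 0 := by
  have key : ∀ g : Polynomial ℝ,
      -(((m : ℝ) + 1) * (m + 1 + b)) *
        powerMoment b ((1 - Polynomial.X) * p * g) =
      powerMoment b ((1 - Polynomial.X) * p * radialLaplacian b (g * (1 - Polynomial.X))) := by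
    intro g
    have h := powerMoment_radialLaplacian_comm hb (f := (1 - Polynomial.X) * p)
      (g := g * (1 - Polynomial.X)) (by simp) (by simp)
    rw [hode, mul_assoc, powerMoment_C_mul, mul_comm _ ((1 - Polynomial.X) * p)] at h
    rw [← h]
    congr 2
    ring
  induction i with
  | zero =>
    have h := key 1
    have hD : radialLaplacian b (1 * (1 - Polynomial.X)) = Polynomial.C (-(b + 1)) := by
      simp [radialLaplacian]
    rw [hD, mul_one, mul_comm _ (Polynomial.C _), powerMoment_C_mul] at h
    rw [pow_zero, mul_one]
    have hm : (1 : ℝ) ≤ m := by exact_mod_cast hi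
    have : (((m : ℝ) + 1) * (m + 1 + b) - (b + 1)) *
        powerMoment b ((1 - Polynomial.X) * p) = 0 := by linarith
    refine (mul_eq_zero.1 this).resolve_left ?_
    nlinarith
  | succ i ih =>
    have h := key (Polynomial.X ^ (i + 1))
    have hD : radialLaplacian b (Polynomial.X ^ (i + 1) * (1 - Polynomial.X)) =
        Polynomial.C (((i : ℝ) + 1) * (i + 1 + b)) * Polynomial.X ^ i -
          Polynomial.C (((i : ℝ) + 2) * (i + 2 + b)) * Polynomial.X ^ (i + 1) := by
      rcases i with _ | i
      · simp [radialLaplacian, Polynomial.derivative_mul]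
        simp only [map_ofNat]
        ring
      · simp [radialLaplacian, Polynomial.derivative_mul]
        simp only [map_ofNat]
        ring
    rw [hD, mul_sub, mul_left_comm, mul_left_comm _ (Polynomial.C _), map_sub,
      powerMoment_C_mul, powerMoment_C_mul, ih (by omega)] at h
    have hm : (i : ℝ) + 2 ≤ m := by exact_mod_cast hi
    have hi0 : (0 : ℝ) ≤ i := i.cast_nonneg
    have : (((m : ℝ) + 1) * (m + 1 + b) - (i + 2) * (i + 2 + b)) *
        powerMoment b ((1 - Polynomial.X) * p * Polynomial.X ^ (i + 1)) = 0 := by linarith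
    refine (mul_eq_zero.1 this).resolve_left ?_
    nlinarith

theorem powerMoment_eigenfunction_mul (hb : -1 < b)
    (hode : radialLaplacian b ((1 - Polynomial.X) * p) =
      Polynomial.C (-(((m : ℝ) + 1) * (m + 1 + b))) * p) {r : Polynomial ℝ}
    (hr : r.degree < m) :
    powerMoment b ((1 - Polynomial.X) * p * r) = 0 := by
  rw [r.as_sum_range_C_mul_X_pow, Finset.mul_sum, map_sum]
  refine Finset.sum_eq_zero fun i _ => ?_
  rw [mul_left_comm, powerMoment_C_mul]
  by_cases hi : i < m
  · rw [powerMoment_eigenfunction_mul_X_pow hb hode i hi, mul_zero]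
  · rw [Polynomial.coeff_eq_zero_of_degree_lt (hr.trans_le (by exact_mod_cast not_lt.1 hi)),
      zero_mul]

/-- A Pohozaev-type argument: every moment involved is a multiple of the wanted one, `N`, and the
fundamental theorem of calculus for `t f'²` equates a multiple of `N` with the boundary value
`f'(1)² = (m+1)²`. -/
theorem powerMoment_eigenfunction_mul_self (hb : -1 < b) (hp : p.natDegree ≤ m)
    (hp1 : p.eval 1 = m + 1)
    (hode : radialLaplacian b ((1 - Polynomial.X) * p) =
      Polynomial.C (-(((m : ℝ) + 1) * (m + 1 + b))) * p) :
    powerMoment b ((1 - Polynomial.X) * p * p) =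
      ((m : ℝ) + 1) / ((m + 1 + b) * (2 * (m + 1) + b)) := by
  set f := (1 - Polynomial.X) * p with hf
  have hf1 : f.eval 1 = 0 := by simp [hf]
  have hf' : Polynomial.derivative f = -p + (1 - Polynomial.X) * Polynomial.derivative p := by
    simp [hf, Polynomial.derivative_mul]
  have hf'1 : (Polynomial.derivative f).eval 1 = -(m + 1) := by
    rw [hf']; simp [hp1]
  have e1 : powerMoment b (f * (Polynomial.X * Polynomial.derivative p)) =
      m * powerMoment b (f * p) := by
    -- The terms of degree `m` cancel, so the eigenfunction is orthogonal to this difference.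
    have hdeg : (Polynomial.X * Polynomial.derivative p - Polynomial.C (m : ℝ) * p).degree <
        (m : WithBot ℕ) := by
      rw [Polynomial.degree_lt_iff_coeff_zero]
      intro k hk
      have h0 : (Polynomial.X * Polynomial.derivative p).coeff k = k * p.coeff k := by
        rcases k with _ | k
        · simp
        · rw [Polynomial.coeff_X_mul, Polynomial.coeff_derivative]
          push_cast
          ring
      rw [Polynomial.coeff_sub, h0, Polynomial.coeff_C_mul]
      rcases hk.eq_or_lt with rfl | hk
      · ring
      · rw [Polynomial.coeff_eq_zero_of_natDegree_lt (by omega)]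
        ring
    have h := powerMoment_eigenfunction_mul hb hode hdeg
    rw [← hf, mul_sub, map_sub, mul_left_comm f (Polynomial.C _), powerMoment_C_mul] at h
    linarith
  have e2 : powerMoment b (Polynomial.X * p * p) = (2 * m + b + 1) * powerMoment b (f * p) := by
    have h := powerMoment_X_mul_derivative hb (f * p)
    have h' : Polynomial.X * Polynomial.derivative (f * p) + Polynomial.C (b + 1) * (f * p) =
        Polynomial.C 2 * (f * (Polynomial.X * Polynomial.derivative p)) +
          Polynomial.C (b + 1) * (f * p) - Polynomial.X * p * p := by
      rw [Polynomial.derivative_mul, hf', hf]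
      simp only [map_ofNat]
      ring
    rw [h', map_sub, map_add, powerMoment_C_mul, powerMoment_C_mul, e1, Polynomial.eval_mul,
      hf1] at h
    linarith
  have e3 : powerMoment b (Polynomial.X * Polynomial.derivative f * p) =
      -(m + b + 1) * powerMoment b (f * p) := by
    have h' : Polynomial.X * Polynomial.derivative f * p =
        f * (Polynomial.X * Polynomial.derivative p) - Polynomial.X * p * p := by
      rw [hf', hf]; ring
    rw [h', map_sub, e1, e2]
    ring
  have e4 : powerMoment b (Polynomial.X * Polynomial.derivative f * Polynomial.derivative f) =
      (((m : ℝ) + 1) * (m + 1 + b)) * powerMoment b (f * p) := by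
    have h := powerMoment_radialLaplacian_mul hb f f
    rw [hode, mul_assoc, powerMoment_C_mul, hf1, mul_comm p f] at h
    linarith
  have e5 := powerMoment_X_mul_derivative hb
    (Polynomial.X * Polynomial.derivative f * Polynomial.derivative f)
  have h5 : Polynomial.X * Polynomial.derivative
        (Polynomial.X * Polynomial.derivative f * Polynomial.derivative f) +
      Polynomial.C (b + 1) * (Polynomial.X * Polynomial.derivative f * Polynomial.derivative f) =
      Polynomial.C 2 * (Polynomial.X * Polynomial.derivative f * radialLaplacian b f) -
        Polynomial.C b * (Polynomial.X * Polynomial.derivative f * Polynomial.derivative f) := by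
    simp only [radialLaplacian, Polynomial.derivative_mul, Polynomial.derivative_X, map_add,
      map_one, map_ofNat]
    ring
  rw [h5, hode, mul_left_comm (Polynomial.X * _) (Polynomial.C _), map_sub, powerMoment_C_mul,
    powerMoment_C_mul, powerMoment_C_mul, e3, e4] at e5
  simp only [Polynomial.eval_mul, Polynomial.eval_X, hf'1] at e5
  have hm : (0 : ℝ) ≤ m := m.cast_nonneg
  have h1 : (0 : ℝ) < m + 1 + b := by linarith
  have h2 : (0 : ℝ) < 2 * (m + 1) + b := by linarith
  rw [eq_div_iff (mul_pos h1 h2).ne']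
  have h3 : (m : ℝ) + 1 ≠ 0 := by linarith
  apply mul_left_cancel₀ h3
  linear_combination e5

end Eigenfunction

/-! ### Jacobi polynomials on the unit interval -/

/-- The coefficients of `P_m^{(1,b)}(2t - 1)` in powers of `t - 1`. -/
noncomputable def jacobiCoeff (b : ℝ) (m k : ℕ) : ℝ :=
  (m.choose k : ℝ) / (m.factorial : ℝ)
    * (ascPochhammer ℝ k).eval ((m : ℝ) + 1 + b + 1)
    * (ascPochhammer ℝ (m - k)).eval (1 + (k : ℝ) + 1)

/-- The hypergeometric ratio of consecutive coefficients, cleared of denominators so that it also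
holds for `k ≥ m`, where both sides vanish. -/
theorem jacobiCoeff_succ (b : ℝ) (m k : ℕ) :
    ((k : ℝ) + 1) * (k + 2) * jacobiCoeff b m (k + 1) =
      ((m : ℝ) - k) * (m + k + b + 2) * jacobiCoeff b m k := by
  rcases lt_trichotomy k m with h | rfl | h
  · obtain ⟨l, rfl⟩ : ∃ l, m = k + 1 + l := ⟨m - (k + 1), by omega⟩
    have hc : ((k + 1 + l).choose (k + 1) : ℝ) * (k + 1) = (k + 1 + l).choose k * (l + 1) := by
      have := Nat.choose_succ_right_eq (k + 1 + l) k
      rw [show k + 1 + l - k = l + 1 by omega] at this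
      exact_mod_cast this
    have h1 : (ascPochhammer ℝ (l + 1)).eval (1 + (k : ℝ) + 1) =
        (k + 2) * (ascPochhammer ℝ l).eval (1 + ((k + 1 : ℕ) : ℝ) + 1) := by
      rw [ascPochhammer_succ_left]
      simp only [Polynomial.eval_mul, Polynomial.eval_X, Polynomial.eval_comp,
        Polynomial.eval_add, Polynomial.eval_one]
      push_cast
      ring_nf
    unfold jacobiCoeff
    rw [show k + 1 + l - (k + 1) = l by omega, show k + 1 + l - k = l + 1 by omega, h1,
      ascPochhammer_succ_eval]
    generalize (ascPochhammer ℝ l).eval (1 + ((k + 1 : ℕ) : ℝ) + 1) = A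
    generalize (ascPochhammer ℝ k).eval (((k + 1 + l : ℕ) : ℝ) + 1 + b + 1) = B
    push_cast
    have hk : ((k + 1 + l).factorial : ℝ) ≠ 0 := by positivity
    field_simp
    linear_combination B * (↑k + 1 + ↑l + 1 + b + 1 + ↑k) * A * hc
  · simp [jacobiCoeff]
  · simp [jacobiCoeff, Nat.choose_eq_zero_of_lt h, Nat.choose_eq_zero_of_lt (h.trans k.lt_succ_self)]

/-- `P_m^{(1,b)}(2t - 1)` as a polynomial in `t - 1`. -/
noncomputable def jacobiShift (b : ℝ) (m : ℕ) : Polynomial ℝ :=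
  ∑ k ∈ Finset.range (m + 1), Polynomial.C (jacobiCoeff b m k) * Polynomial.X ^ k

/-- `P_m^{(1,b)}(2t - 1)`. -/
noncomputable def jacobiUnit (b : ℝ) (m : ℕ) : Polynomial ℝ :=
  (jacobiShift b m).comp (Polynomial.X - 1)

theorem jacobi_comp_eq (b : ℝ) (m : ℕ) :
    (jacobi 1 b m).comp (2 * Polynomial.X - 1) = jacobiUnit b m := by
  have h : (Polynomial.C (1 / 2 : ℝ) * (2 * Polynomial.X - 1 - 1)) = Polynomial.X - 1 := by
    have : Polynomial.C (1 / 2 : ℝ) * 2 = 1 := by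
      rw [← Polynomial.C_ofNat, ← Polynomial.C_mul]; norm_num
    linear_combination (Polynomial.X - 1) * this
  simp only [jacobi, jacobiUnit, jacobiShift, Polynomial.sum_comp, Polynomial.mul_comp,
    Polynomial.C_comp, Polynomial.pow_comp, Polynomial.X_comp, Polynomial.sub_comp,
    Polynomial.one_comp, h]
  rfl

theorem coeff_jacobiShift (b : ℝ) (m k : ℕ) :
    (jacobiShift b m).coeff k = jacobiCoeff b m k := by
  simp only [jacobiShift, Polynomial.finsetSum_coeff, Polynomial.coeff_C_mul_X_pow]
  rw [Finset.sum_ite_eq]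
  split_ifs with h
  · rfl
  · simp [jacobiCoeff, Nat.choose_eq_zero_of_lt (show m < k by simpa using h)]

/-- Comparing coefficients of `X ^ k` gives exactly `jacobiCoeff_succ`. -/
theorem jacobiShift_ode (b : ℝ) (m : ℕ) :
    (Polynomial.X ^ 2 + Polynomial.X) *
        Polynomial.derivative (Polynomial.derivative (jacobiShift b m)) +
      (2 + Polynomial.C (b + 3) * Polynomial.X) * Polynomial.derivative (jacobiShift b m) =
      Polynomial.C ((m : ℝ) * (m + b + 2)) * jacobiShift b m := by
  ext k
  have h := jacobiCoeff_succ b m k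
  simp only [← coeff_jacobiShift] at h
  generalize jacobiShift b m = q at h ⊢
  rw [add_mul, add_mul, pow_two, mul_assoc, mul_assoc (Polynomial.C _), ← Polynomial.C_ofNat]
  simp only [Polynomial.coeff_add, Polynomial.coeff_C_mul]
  rcases k with _ | _ | k
  · simp [Polynomial.coeff_derivative] at h ⊢
    linarith
  · simp [Polynomial.coeff_derivative, Polynomial.coeff_X_mul] at h ⊢
    linarith
  · simp [Polynomial.coeff_derivative, Polynomial.coeff_X_mul] at h ⊢
    linarith

/-- After the shift to `t`, the product rule for `(1-t) p` gives minus the left side of the Jacobi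
equation, less `(b+1) p`; and `m(m+b+2) + b + 1 = (m+1)(m+1+b)`. -/
theorem jacobiUnit_ode (b : ℝ) (m : ℕ) :
    radialLaplacian b ((1 - Polynomial.X) * jacobiUnit b m) =
      Polynomial.C (-(((m : ℝ) + 1) * (m + 1 + b))) * jacobiUnit b m := by
  have h := congrArg (fun q => q.comp (Polynomial.X - 1)) (jacobiShift_ode b m)
  simp only [Polynomial.add_comp, Polynomial.mul_comp, Polynomial.C_comp, Polynomial.X_comp,
    Polynomial.pow_comp, Polynomial.ofNat_comp] at h
  have hd : ∀ q : Polynomial ℝ, Polynomial.derivative (q.comp (Polynomial.X - 1)) =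
      (Polynomial.derivative q).comp (Polynomial.X - 1) := fun q => by
    simp [Polynomial.derivative_comp]
  simp only [radialLaplacian, jacobiUnit, Polynomial.derivative_mul, hd,
    Polynomial.derivative_sub, Polynomial.derivative_one, Polynomial.derivative_X,
    Polynomial.derivative_add, Polynomial.derivative_zero]
  simp only [map_add, map_mul, map_neg, map_one, map_ofNat, map_natCast] at h ⊢
  linear_combination -h

theorem jacobiCoeff_self_pos {b : ℝ} (hb : -1 < b) (m : ℕ) : 0 < jacobiCoeff b m m := by
  have hm : (0 : ℝ) ≤ m := m.cast_nonneg
  have := ascPochhammer_pos m ((m : ℝ) + 1 + b + 1) (by linarith)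
  simp only [jacobiCoeff, Nat.choose_self, Nat.sub_self, ascPochhammer_zero, Polynomial.eval_one]
  positivity

theorem natDegree_jacobiUnit {b : ℝ} (hb : -1 < b) (m : ℕ) : (jacobiUnit b m).natDegree = m := by
  have h : (jacobiShift b m).natDegree = m := by
    refine le_antisymm ?_ (Polynomial.le_natDegree_of_ne_zero ?_)
    · refine Polynomial.natDegree_sum_le_of_forall_le _ _ fun k hk => ?_
      exact (Polynomial.natDegree_C_mul_X_pow_le _ _).trans (by simpa [Nat.lt_succ_iff] using hk)
    · rw [coeff_jacobiShift]
      exact (jacobiCoeff_self_pos hb m).ne'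
  rw [jacobiUnit, Polynomial.natDegree_comp, h, ← Polynomial.C_1, Polynomial.natDegree_X_sub_C,
    mul_one]

theorem eval_one_jacobiUnit (b : ℝ) (m : ℕ) : (jacobiUnit b m).eval 1 = m + 1 := by
  rw [jacobiUnit, Polynomial.eval_comp]
  simp only [Polynomial.eval_sub, Polynomial.eval_X, Polynomial.eval_one, sub_self]
  rw [← Polynomial.coeff_zero_eq_eval_zero, coeff_jacobiShift]
  have h := factorial_mul_ascPochhammer ℝ 1 m
  have hm : (m.factorial : ℝ) ≠ 0 := by positivity
  rw [Nat.factorial_one, Nat.cast_one, one_mul, add_comm 1 m, Nat.factorial_succ] at h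
  simp only [jacobiCoeff, Nat.choose_zero_right, ascPochhammer_zero, Polynomial.eval_one,
    Nat.sub_zero, Nat.cast_zero, add_zero, mul_one, Nat.cast_one]
  rw [h]
  push_cast
  field_simp

theorem powerMoment_jacobiUnit_mul {b : ℝ} (hb : -1 < b) {m : ℕ} {r : Polynomial ℝ}
    (hr : r.degree < m) :
    powerMoment b ((1 - Polynomial.X) * jacobiUnit b m * r) = 0 :=
  powerMoment_eigenfunction_mul hb (jacobiUnit_ode b m) hr

theorem powerMoment_jacobiUnit_mul_self {b : ℝ} (hb : -1 < b) (m : ℕ) :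
    powerMoment b ((1 - Polynomial.X) * jacobiUnit b m * jacobiUnit b m) =
      ((m : ℝ) + 1) / ((m + 1 + b) * (2 * (m + 1) + b)) :=
  powerMoment_eigenfunction_mul_self hb (natDegree_jacobiUnit hb m).le (eval_one_jacobiUnit b m)
    (jacobiUnit_ode b m)

/-! ### Green's identity and spherical means of harmonics -/

/-- The Euler operator `∑ xᵢ ∂ᵢ`. -/
noncomputable def euler {d : ℕ} (f : Poly d) : Poly d :=
  ∑ i, MvPolynomial.X i * MvPolynomial.pderiv i f

theorem euler_of_isHomogeneous {d e : ℕ} {f : Poly d} (hf : f.IsHomogeneous e) :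
    euler f = (e : ℝ) • f := by
  rw [euler, hf.sum_X_mul_pderiv, Nat.cast_smul_eq_nsmul]

theorem laplacian_apply {d : ℕ} (f : Poly d) :
    laplacian d f = ∑ i, MvPolynomial.pderiv i (MvPolynomial.pderiv i f) := by
  simp [laplacian]

/-- Green's identity on the unit ball. -/
theorem ballMean_green {d : ℕ} (hd : 1 ≤ d) (f g : Poly d) :
    ballMean d (∑ i, MvPolynomial.pderiv i f * MvPolynomial.pderiv i g) +
      ballMean d (f * laplacian d g) = sphereMean d (f * euler g) := by
  rw [← map_add, laplacian_apply, Finset.mul_sum, ← Finset.sum_add_distrib, map_sum, euler,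
    Finset.mul_sum, map_sum]
  refine Finset.sum_congr rfl fun i _ => ?_
  rw [mul_left_comm f, ← ballMean_pderiv hd]
  congr 1
  rw [Derivation.leibniz]
  simp only [smul_eq_mul]
  ring

theorem isHomogeneous_laplacian {d e : ℕ} {f : Poly d} (hf : f.IsHomogeneous (e + 2)) :
    (laplacian d f).IsHomogeneous e := by
  rw [laplacian_apply]
  refine MvPolynomial.IsHomogeneous.sum _ _ _ fun i _ => ?_
  exact (hf.pderiv (i := i)).pderiv (i := i)

theorem laplacian_eq_zero_of_lt_two {d e : ℕ} {f : Poly d} (hf : f.IsHomogeneous e)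
    (he : e < 2) : laplacian d f = 0 := by
  rw [laplacian_apply]
  refine Finset.sum_eq_zero fun i _ => ?_
  have h : (MvPolynomial.pderiv i f).IsHomogeneous 0 := by
    have := hf.pderiv (i := i)
    rwa [show e - 1 = 0 by omega] at this
  rw [MvPolynomial.totalDegree_eq_zero_iff_eq_C.1
    ((MvPolynomial.totalDegree_zero_iff_isHomogeneous _).2 h), MvPolynomial.pderiv_C]

theorem laplacian_of_mem_harmonics {d n : ℕ} {Y : Poly d} (hY : Y ∈ harmonics d n) :
    laplacian d Y = 0 := hY.2

theorem isHomogeneous_of_mem_harmonics {d n : ℕ} {Y : Poly d} (hY : Y ∈ harmonics d n) :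
    Y.IsHomogeneous n := hY.1

theorem map_eq_zero_of_homogeneousComponent {d n : ℕ} (φ : Poly d →ₗ[ℝ] ℝ)
    (h : ∀ e < n, ∀ F : Poly d, F.IsHomogeneous e → φ F = 0) {F : Poly d}
    (hF : F.totalDegree < n) : φ F = 0 := by
  rw [← MvPolynomial.sum_homogeneousComponent F, map_sum]
  refine Finset.sum_eq_zero fun e he => h e ?_ _
    (MvPolynomial.homogeneousComponent_isHomogeneous e F)
  have := Finset.mem_range.1 he
  omega

/-- Green's identity used both ways gives `(n - m)` times the mean as a ball integral of `Y ΔF`,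
which vanishes by induction since `ΔF` has degree `m - 2`. -/
theorem sphereMean_mul_harmonic {d n m : ℕ} (hd : 1 ≤ d) {Y : Poly d} (hY : Y ∈ harmonics d n)
    (hm : m < n) {F : Poly d} (hF : F.IsHomogeneous m) : sphereMean d (F * Y) = 0 := by
  induction m using Nat.strong_induction_on generalizing F with
  | _ m ih =>
    have h1 := ballMean_green hd F Y
    have h2 := ballMean_green hd Y F
    have h0 : ballMean d (Y * laplacian d F) = 0 := by
      rcases lt_or_ge m 2 with h | h
      · rw [laplacian_eq_zero_of_lt_two hF h, mul_zero, map_zero]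
      · obtain ⟨k, rfl⟩ := Nat.exists_eq_add_of_le' h
        have hL := isHomogeneous_laplacian hF
        rw [mul_comm, ballMean_of_isHomogeneous hd (hL.mul (isHomogeneous_of_mem_harmonics hY)),
          ih k (by omega) (by omega) hL, zero_div]
    rw [laplacian_of_mem_harmonics hY, mul_zero, map_zero,
      euler_of_isHomogeneous (isHomogeneous_of_mem_harmonics hY), mul_smul_comm, map_smul,
      smul_eq_mul] at h1
    rw [h0, euler_of_isHomogeneous hF, mul_smul_comm, map_smul, smul_eq_mul, mul_comm Y F] at h2
    simp only [mul_comm (MvPolynomial.pderiv _ Y)] at h2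
    have h3 : ((n : ℝ) - m) * sphereMean d (F * Y) = 0 := by linarith
    refine (mul_eq_zero.1 h3).resolve_left ?_
    have : (m : ℝ) < n := by exact_mod_cast hm
    linarith

theorem sphereMean_mul_harmonic_of_totalDegree_lt {d n : ℕ} (hd : 1 ≤ d) {Y : Poly d}
    (hY : Y ∈ harmonics d n) {F : Poly d} (hF : F.totalDegree < n) :
    sphereMean d (F * Y) = 0 :=
  map_eq_zero_of_homogeneousComponent (sphereMean d ∘ₗ LinearMap.mulRight ℝ Y)
    (fun _ he _ hG => sphereMean_mul_harmonic hd hY he hG) hF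

theorem sphereMean_harmonic_mul_harmonic {d k l : ℕ} (hd : 1 ≤ d) {Y Z : Poly d}
    (hY : Y ∈ harmonics d k) (hZ : Z ∈ harmonics d l) (h : k ≠ l) :
    sphereMean d (Y * Z) = 0 := by
  rcases h.lt_or_gt with h | h
  · exact sphereMean_mul_harmonic hd hZ h (isHomogeneous_of_mem_harmonics hY)
  · rw [mul_comm]
    exact sphereMean_mul_harmonic hd hY h (isHomogeneous_of_mem_harmonics hZ)

/-- Green's identity against `1` expresses `e` times the mean through `ΔF`, of odd degree `e - 2`;
the descent ends at degree `1`, where `ΔF = 0`. -/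
theorem sphereMean_of_odd {d e : ℕ} (hd : 1 ≤ d) (he : Odd e) {F : Poly d}
    (hF : F.IsHomogeneous e) : sphereMean d F = 0 := by
  induction e using Nat.strong_induction_on generalizing F with
  | _ e ih =>
    have h := ballMean_green hd 1 F
    have h0 : ballMean d (laplacian d F) = 0 := by
      rcases lt_or_ge e 2 with h | h
      · rw [laplacian_eq_zero_of_lt_two hF h, map_zero]
      · obtain ⟨k, rfl⟩ := Nat.exists_eq_add_of_le' h
        have hL := isHomogeneous_laplacian hF
        rw [ballMean_of_isHomogeneous hd hL,
          ih k (by omega) (by simpa [Nat.odd_add] using he) hL, zero_div]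
    rw [one_mul, one_mul, h0, euler_of_isHomogeneous hF, map_smul, smul_eq_mul] at h
    simp only [MvPolynomial.pderiv_one, zero_mul, Finset.sum_const_zero, map_zero,
      add_zero] at h
    exact (mul_eq_zero.1 h.symm).resolve_left (by exact_mod_cast he.pos.ne')

/-! ### Radial factors times harmonics -/

theorem isHomogeneous_normSq (d : ℕ) : (normSq d).IsHomogeneous 2 :=
  MvPolynomial.IsHomogeneous.sum _ _ _ fun i _ => MvPolynomial.isHomogeneous_X_pow i 2

theorem pderiv_normSq {d : ℕ} (i : Fin d) :
    MvPolynomial.pderiv i (normSq d) = 2 * MvPolynomial.X i := by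
  rw [normSq, map_sum, Finset.sum_eq_single i]
  · rw [MvPolynomial.pderiv_pow, MvPolynomial.pderiv_X_self]
    simp
  · intro j _ hj
    rw [MvPolynomial.pderiv_pow, MvPolynomial.pderiv_X_of_ne hj, mul_zero]
  · simp

theorem pderiv_aeval_normSq {d : ℕ} (i : Fin d) (g : Polynomial ℝ) :
    MvPolynomial.pderiv i (Polynomial.aeval (normSq d) g) =
      Polynomial.aeval (normSq d) (Polynomial.derivative g) * (2 * MvPolynomial.X i) := by
  rw [Derivation.map_aeval, pderiv_normSq, smul_eq_mul]

/-- The first-order terms are `2d g' Y` from the radial part and `4k g' Y` from Euler's identity;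
their sum is `4(b+1) g' Y`, which fixes `b`. -/
theorem laplacian_aeval_normSq_mul {d k : ℕ} {Y : Poly d} (hY : Y ∈ harmonics d k)
    (g : Polynomial ℝ) :
    laplacian d (Polynomial.aeval (normSq d) g * Y) =
      4 * (Polynomial.aeval (normSq d)
        (radialLaplacian ((k : ℝ) + ((d : ℝ) - 2) / 2) g) * Y) := by
  have h : ∀ i, MvPolynomial.pderiv i (MvPolynomial.pderiv i
      (Polynomial.aeval (normSq d) g * Y)) =
      4 * Polynomial.aeval (normSq d) (Polynomial.derivative (Polynomial.derivative g)) * Y *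
          MvPolynomial.X i ^ 2 +
        2 * Polynomial.aeval (normSq d) (Polynomial.derivative g) * Y +
        4 * Polynomial.aeval (normSq d) (Polynomial.derivative g) *
          (MvPolynomial.X i * MvPolynomial.pderiv i Y) +
        Polynomial.aeval (normSq d) g * MvPolynomial.pderiv i (MvPolynomial.pderiv i Y) := by
    intro i
    have h2 : MvPolynomial.pderiv i (2 : Poly d) = 0 := by
      rw [show (2 : Poly d) = MvPolynomial.C 2 from rfl, MvPolynomial.pderiv_C]
    simp only [MvPolynomial.pderiv_mul, pderiv_aeval_normSq, map_add, h2,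
      MvPolynomial.pderiv_X_self]
    ring
  have hE := euler_of_isHomogeneous (isHomogeneous_of_mem_harmonics hY)
  have hL := laplacian_of_mem_harmonics hY
  rw [euler] at hE
  rw [laplacian_apply] at hL ⊢
  simp only [h, Finset.sum_add_distrib, ← Finset.mul_sum, hE, hL, Finset.sum_const,
    Finset.card_univ, Fintype.card_fin]
  have hc : (Polynomial.aeval (normSq d)) (Polynomial.C ((k : ℝ) + ((d : ℝ) - 2) / 2 + 1)) * 2 =
      (2 * k + d : Poly d) := by
    rw [Polynomial.aeval_C, MvPolynomial.algebraMap_eq,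
      show (2 : Poly d) = MvPolynomial.C 2 from rfl, ← map_natCast MvPolynomial.C k,
      ← map_natCast MvPolynomial.C d, ← map_mul, ← map_mul, ← map_add]
    congr 1
    ring
  simp only [radialLaplacian, map_add, map_mul, Polynomial.aeval_X, Nat.cast_smul_eq_nsmul,
    nsmul_eq_mul] at hc ⊢
  change 4 * _ * Y * normSq d + _ + _ + _ = _
  linear_combination (-2 * Polynomial.aeval (normSq d) (Polynomial.derivative g) * Y) * hc

theorem sphereMean_normSq_pow_mul {d : ℕ} (i : ℕ) (F : Poly d) :
    sphereMean d (normSq d ^ i * F) = sphereMean d F := by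
  induction i with
  | zero => simp
  | succ i ih => rw [pow_succ', mul_assoc, sphereMean_normSq_mul, ih]

/-- This is the substitution `t = r²`, for which `r^{e+d-1} dr = ½ t^{(e+d-2)/2} dt`. -/
theorem ballMean_aeval_normSq_mul {d e : ℕ} (hd : 1 ≤ d) {H : Poly d} (hH : H.IsHomogeneous e)
    (h : Polynomial ℝ) :
    ballMean d (Polynomial.aeval (normSq d) h * H) =
      sphereMean d H / 2 * powerMoment (((e : ℝ) + d - 2) / 2) h := by
  induction h using Polynomial.induction_on' with
  | add p q hp hq => rw [map_add, add_mul, map_add, hp, hq, map_add, mul_add]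
  | monomial i a =>
    have hi : (normSq d ^ i * H).IsHomogeneous (2 * i + e) :=
      ((isHomogeneous_normSq d).pow i).mul hH
    rw [Polynomial.aeval_monomial, MvPolynomial.algebraMap_eq, mul_assoc,
      ← MvPolynomial.smul_eq_C_mul, map_smul, ballMean_of_isHomogeneous hd hi,
      sphereMean_normSq_pow_mul, powerMoment_monomial, smul_eq_mul]
    have hd' : (1 : ℝ) ≤ d := by exact_mod_cast hd
    have h1 : ((2 * i + e : ℕ) : ℝ) + d ≠ 0 := by positivity
    have h2 : (i : ℝ) + ((e : ℝ) + d - 2) / 2 + 1 = (((2 * i + e : ℕ) : ℝ) + d) / 2 := by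
      push_cast; ring
    rw [h2]
    field_simp

theorem powerMoment_mul_X_pow (b : ℝ) (q : Polynomial ℝ) (i : ℕ) :
    powerMoment b (q * Polynomial.X ^ i) = powerMoment (b + i) q := by
  induction q using Polynomial.induction_on' with
  | add p q hp hq => rw [add_mul, map_add, map_add, hp, hq]
  | monomial n a =>
    rw [Polynomial.monomial_mul_X_pow, powerMoment_monomial, powerMoment_monomial]
    push_cast
    ring_nf

/-! ### Sobolev products of the polynomials vanishing on the sphere -/

/-- The polynomial `(1 - ‖x‖²) P_m^{(1, k + (d-2)/2)}(2‖x‖² - 1) Y(x)`. -/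
noncomputable def bubble (d k m : ℕ) (Y : Poly d) : Poly d :=
  Polynomial.aeval (normSq d)
    ((1 - Polynomial.X) * jacobiUnit ((k : ℝ) + ((d : ℝ) - 2) / 2) m) * Y

theorem neg_one_lt_param {d : ℕ} (hd : 1 ≤ d) (k : ℕ) :
    -1 < (k : ℝ) + ((d : ℝ) - 2) / 2 := by
  have hd' : (1 : ℝ) ≤ d := by exact_mod_cast hd
  have hk : (0 : ℝ) ≤ k := k.cast_nonneg
  linarith

/-- Indexing by the harmonic degree `k` instead of `n` removes the subtraction `n - 2j`. -/
theorem sobolevU_succ_eq_bubble (d k m : ℕ) (Y : Poly d) :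
    sobolevU d (k + 2 * (m + 1)) (m + 1) Y = bubble d k m Y := by
  have hb : (((k + 2 * (m + 1) : ℕ) : ℝ) - 2 * ((m + 1 : ℕ) : ℝ) + ((d : ℝ) - 2) / 2) =
      (k : ℝ) + ((d : ℝ) - 2) / 2 := by push_cast; ring
  rw [sobolevU, if_neg m.succ_ne_zero, hb, bubble, ← jacobi_comp_eq, map_mul,
    Polynomial.aeval_comp]
  simp only [map_sub, map_mul, map_one, map_ofNat, Polynomial.aeval_X,
    Nat.add_sub_cancel]

theorem laplacian_bubble {d k : ℕ} (m : ℕ) {Y : Poly d} (hY : Y ∈ harmonics d k) :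
    laplacian d (bubble d k m Y) =
      (-4 * (((m : ℝ) + 1) * (m + 1 + ((k : ℝ) + ((d : ℝ) - 2) / 2)))) •
        (Polynomial.aeval (normSq d) (jacobiUnit ((k : ℝ) + ((d : ℝ) - 2) / 2) m) * Y) := by
  rw [bubble, laplacian_aeval_normSq_mul hY, jacobiUnit_ode, ← Polynomial.smul_eq_C_mul, map_smul,
    smul_mul_assoc, mul_smul_comm, neg_mul_comm, mul_comm (4 : ℝ), mul_smul]
  congr 1
  rw [MvPolynomial.smul_eq_C_mul]
  rfl

theorem sphereMean_bubble_mul {d : ℕ} (k m : ℕ) (Y F : Poly d) :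
    sphereMean d (bubble d k m Y * F) = 0 := by
  have h : bubble d k m Y * F =
      (Polynomial.aeval (normSq d) (jacobiUnit ((k : ℝ) + ((d : ℝ) - 2) / 2) m) * Y * F) -
      normSq d *
      (Polynomial.aeval (normSq d) (jacobiUnit ((k : ℝ) + ((d : ℝ) - 2) / 2) m) * Y * F) := by
    simp only [bubble, map_mul, map_sub, map_one, Polynomial.aeval_X]
    ring
  rw [h, map_sub, sphereMean_normSq_mul, sub_self]

theorem sobolevInner_comm {d : ℕ} (lam : ℝ) (f g : Poly d) :
    sobolevInner lam f g = sobolevInner lam g f := by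
  simp only [sobolevInner_eq, mul_comm]

theorem sobolevInner_bubble_left {d : ℕ} (hd : 1 ≤ d) (lam : ℝ) (k m : ℕ) (Y f : Poly d) :
    sobolevInner lam (bubble d k m Y) f =
      -lam * ballMean d (bubble d k m Y * laplacian d f) := by
  have h := ballMean_green hd (bubble d k m Y) f
  rw [sphereMean_bubble_mul] at h
  rw [sobolevInner_eq, sphereMean_bubble_mul, eq_neg_of_add_eq_zero_left h]
  ring

theorem sobolevInner_harmonic_right {d n : ℕ} (hd : 1 ≤ d) (lam : ℝ) {Y : Poly d}
    (hY : Y ∈ harmonics d n) (f : Poly d) :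
    sobolevInner lam f Y = (lam * n + 1) * sphereMean d (f * Y) := by
  have h := ballMean_green hd f Y
  rw [laplacian_of_mem_harmonics hY, mul_zero, map_zero, add_zero,
    euler_of_isHomogeneous (isHomogeneous_of_mem_harmonics hY), mul_smul_comm, map_smul,
    smul_eq_mul] at h
  rw [sobolevInner_eq, h]
  ring

/-- The Laplacian strips the factor `1 - ‖x‖²` from the second argument, so exactly one copy of the
Jacobi weight `1 - t` remains. -/
theorem sobolevInner_bubble_bubble {d k l : ℕ} (hd : 1 ≤ d) (lam : ℝ) (m r : ℕ) {Y Z : Poly d}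
    (hY : Y ∈ harmonics d k) (hZ : Z ∈ harmonics d l) :
    sobolevInner lam (bubble d k m Y) (bubble d l r Z) =
      2 * lam * (((r : ℝ) + 1) * (r + 1 + ((l : ℝ) + ((d : ℝ) - 2) / 2))) *
        sphereMean d (Y * Z) * powerMoment (((k + l : ℕ) + (d : ℝ) - 2) / 2)
          ((1 - Polynomial.X) * jacobiUnit ((k : ℝ) + ((d : ℝ) - 2) / 2) m *
            jacobiUnit ((l : ℝ) + ((d : ℝ) - 2) / 2) r) := by
  have h := ballMean_aeval_normSq_mul hd ((isHomogeneous_of_mem_harmonics hY).mul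
    (isHomogeneous_of_mem_harmonics hZ))
    ((1 - Polynomial.X) * jacobiUnit ((k : ℝ) + ((d : ℝ) - 2) / 2) m *
            jacobiUnit ((l : ℝ) + ((d : ℝ) - 2) / 2) r)
  rw [map_mul (Polynomial.aeval (normSq d)), mul_mul_mul_comm] at h
  rw [sobolevInner_bubble_left hd, laplacian_bubble r hZ, mul_smul_comm, map_smul, smul_eq_mul,
    bubble, h]
  ring

theorem sobolevInner_bubble_self {d k : ℕ} (hd : 1 ≤ d) (lam : ℝ) (m : ℕ) {Y : Poly d}
    (hY : Y ∈ harmonics d k) :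
    sobolevInner lam (bubble d k m Y) (bubble d k m Y) =
      2 * ((m : ℝ) + 1) ^ 2 * lam / (2 * (m + 1) + ((k : ℝ) + ((d : ℝ) - 2) / 2)) *
        sphereMean d (Y * Y) := by
  have hb := neg_one_lt_param hd k
  have e : (((k + k : ℕ) : ℝ) + (d : ℝ) - 2) / 2 = (k : ℝ) + ((d : ℝ) - 2) / 2 := by
    push_cast; ring
  rw [sobolevInner_bubble_bubble hd lam m m hY hY, e, powerMoment_jacobiUnit_mul_self hb]
  generalize (k : ℝ) + ((d : ℝ) - 2) / 2 = b at hb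
  have hm : (0 : ℝ) ≤ m := m.cast_nonneg
  have h1 : (m : ℝ) + 1 + b ≠ 0 := by linarith
  have h2 : 2 * ((m : ℝ) + 1) + b ≠ 0 := by linarith
  field_simp

/-- For a component of degree `q + 2`, the Laplacian has degree `q`. If `q < k`, harmonicity of `Y`
gives zero; if `q - k` is odd, parity does; if `q = k + 2i`, the extra radial factor is `t^i` with
`i < m`, and Jacobi orthogonality applies. -/
theorem sobolevInner_bubble_of_totalDegree_lt {d k : ℕ} (hd : 1 ≤ d) (lam : ℝ) (m : ℕ)
    {Y : Poly d} (hY : Y ∈ harmonics d k) {f : Poly d} (hf : f.totalDegree < k + 2 * (m + 1)) :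
    sobolevInner lam (bubble d k m Y) f = 0 := by
  rw [sobolevInner_bubble_left hd]
  refine mul_eq_zero_of_right _ ?_
  refine map_eq_zero_of_homogeneousComponent
    (ballMean d ∘ₗ LinearMap.mulLeft ℝ (bubble d k m Y) ∘ₗ laplacian d) (fun e he F hF => ?_) hf
  simp only [LinearMap.comp_apply, LinearMap.mulLeft_apply]
  rcases lt_or_ge e 2 with h | h
  · rw [laplacian_eq_zero_of_lt_two hF h, mul_zero, map_zero]
  obtain ⟨q, rfl⟩ := Nat.exists_eq_add_of_le' h
  have hL := isHomogeneous_laplacian hF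
  have hYh := isHomogeneous_of_mem_harmonics hY
  rw [bubble, mul_assoc, ballMean_aeval_normSq_mul hd (hYh.mul hL)]
  rcases lt_or_ge q k with hqk | hqk
  · rw [mul_comm Y, sphereMean_mul_harmonic hd hY hqk hL, zero_div, zero_mul]
  obtain ⟨s, rfl⟩ := Nat.exists_eq_add_of_le hqk
  rcases Nat.even_or_odd' s with ⟨i, rfl | rfl⟩
  · have e : (((k + (k + 2 * i) : ℕ) : ℝ) + d - 2) / 2 = (k : ℝ) + ((d : ℝ) - 2) / 2 + i := by
      push_cast; ring
    rw [e, ← powerMoment_mul_X_pow, powerMoment_jacobiUnit_mul (neg_one_lt_param hd k), mul_zero]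
    rw [Polynomial.degree_X_pow]
    exact_mod_cast (by omega : i < m)
  · rw [sphereMean_of_odd hd ⟨k + i, by omega⟩ (hYh.mul hL), zero_div, zero_mul]

theorem totalDegree_aeval_normSq_le (d : ℕ) (h : Polynomial ℝ) :
    (Polynomial.aeval (normSq d) h).totalDegree ≤ 2 * h.natDegree := by
  rw [Polynomial.aeval_eq_sum_range]
  refine MvPolynomial.totalDegree_finsetSum_le fun i hi => ?_
  refine (MvPolynomial.totalDegree_smul_le _ _).trans ?_
  refine ((isHomogeneous_normSq d).pow i).totalDegree_le.trans ?_
  have := Finset.mem_range.1 hi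
  omega

theorem natDegree_one_sub_X_mul_jacobiUnit {b : ℝ} (hb : -1 < b) (m : ℕ) :
    ((1 - Polynomial.X) * jacobiUnit b m).natDegree = m + 1 := by
  have h : (1 - Polynomial.X : Polynomial ℝ) = -(Polynomial.X - Polynomial.C 1) := by simp
  have h0 : jacobiUnit b m ≠ 0 := fun h0 => by
    have := eval_one_jacobiUnit b m
    rw [h0, Polynomial.eval_zero] at this
    have hm : (0 : ℝ) ≤ m := m.cast_nonneg
    linarith
  rw [h, neg_mul, Polynomial.natDegree_neg,
    Polynomial.natDegree_mul (Polynomial.X_sub_C_ne_zero 1) h0, Polynomial.natDegree_X_sub_C,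
    natDegree_jacobiUnit hb, add_comm]

theorem totalDegree_bubble_le {d k : ℕ} (hd : 1 ≤ d) (m : ℕ) {Y : Poly d}
    (hY : Y ∈ harmonics d k) : (bubble d k m Y).totalDegree ≤ k + 2 * (m + 1) := by
  refine (MvPolynomial.totalDegree_mul _ _).trans ?_
  have h1 := totalDegree_aeval_normSq_le d
    ((1 - Polynomial.X) * jacobiUnit ((k : ℝ) + ((d : ℝ) - 2) / 2) m)
  rw [natDegree_one_sub_X_mul_jacobiUnit (neg_one_lt_param hd k)] at h1
  have h2 := (isHomogeneous_of_mem_harmonics hY).totalDegree_le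
  omega

/-! ### Fischer decomposition -/

/-- The span of the products `‖x‖^{2i} H` of degree `n` with `H` harmonic and homogeneous. -/
noncomputable def fischerSpan (d n : ℕ) : Submodule ℝ (Poly d) :=
  Submodule.span ℝ {F | ∃ i k, k + 2 * i = n ∧ ∃ H ∈ harmonics d k, F = normSq d ^ i * H}

theorem isHomogeneous_of_mem_fischerSpan {d n : ℕ} {F : Poly d} (hF : F ∈ fischerSpan d n) :
    F.IsHomogeneous n := by
  have h : fischerSpan d n ≤ MvPolynomial.homogeneousSubmodule (Fin d) ℝ n := by
    refine Submodule.span_le.2 ?_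
    rintro _ ⟨i, k, rfl, H, hH, rfl⟩
    have := ((isHomogeneous_normSq d).pow i).mul (isHomogeneous_of_mem_harmonics hH)
    rwa [add_comm] at this
  exact h hF

theorem mem_fischerSpan_of_mem_harmonics {d n : ℕ} {H : Poly d} (hH : H ∈ harmonics d n) :
    H ∈ fischerSpan d n :=
  Submodule.subset_span ⟨0, n, rfl, H, hH, by simp⟩

theorem laplacian_normSq_pow_mul {d k : ℕ} (i : ℕ) {H : Poly d} (hH : H ∈ harmonics d k) :
    laplacian d (normSq d ^ (i + 1) * H) =
      (4 * (((i : ℝ) + 1) * (i + 1 + ((k : ℝ) + ((d : ℝ) - 2) / 2)))) • (normSq d ^ i * H) := by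
  have h := laplacian_aeval_normSq_mul hH (Polynomial.X ^ (i + 1))
  have hr : radialLaplacian ((k : ℝ) + ((d : ℝ) - 2) / 2) (Polynomial.X ^ (i + 1)) =
      (((i : ℝ) + 1) * (i + 1 + ((k : ℝ) + ((d : ℝ) - 2) / 2))) • Polynomial.X ^ i := by
    rw [Polynomial.smul_eq_C_mul]
    generalize (k : ℝ) + ((d : ℝ) - 2) / 2 = b
    rcases i with _ | i
    · simp [radialLaplacian]
      ring
    · simp [radialLaplacian]
      ring
  rw [hr, map_smul] at h
  simp only [map_pow, Polynomial.aeval_X] at h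
  rw [h, mul_smul (4 : ℝ), smul_mul_assoc, MvPolynomial.smul_eq_C_mul _ (4 : ℝ)]
  rfl

/-- The Laplacian sends `‖x‖^{2i+2} H` to a multiple of `‖x‖^{2i} H`, nonzero because `b > -1`. -/
theorem exists_laplacian_eq_of_mem_fischerSpan {d n : ℕ} (hd : 1 ≤ d) {Q : Poly d}
    (hQ : Q ∈ fischerSpan d n) : ∃ R ∈ fischerSpan d (n + 2), laplacian d R = Q := by
  have h : fischerSpan d n ≤ (fischerSpan d (n + 2)).map (laplacian d) := by
    refine Submodule.span_le.2 ?_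
    rintro _ ⟨i, k, rfl, H, hH, rfl⟩
    have hb := neg_one_lt_param hd k
    have hi : (0 : ℝ) ≤ i := i.cast_nonneg
    have hne : 4 * (((i : ℝ) + 1) * (i + 1 + ((k : ℝ) + ((d : ℝ) - 2) / 2))) ≠ 0 := by
      refine mul_ne_zero four_ne_zero (mul_ne_zero ?_ ?_) <;> linarith
    refine ⟨(4 * (((i : ℝ) + 1) * (i + 1 + ((k : ℝ) + ((d : ℝ) - 2) / 2))))⁻¹ •
      (normSq d ^ (i + 1) * H), Submodule.smul_mem _ _ (Submodule.subset_span
        ⟨i + 1, k, by ring, H, hH, rfl⟩), ?_⟩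
    rw [map_smul, laplacian_normSq_pow_mul i hH, inv_smul_smul₀ hne]
  exact h hQ

/-- Every homogeneous polynomial is a combination of the `‖x‖^{2i} H` with `H` harmonic. -/
theorem mem_fischerSpan_of_isHomogeneous {d n : ℕ} (hd : 1 ≤ d) {F : Poly d}
    (hF : F.IsHomogeneous n) : F ∈ fischerSpan d n := by
  induction n using Nat.strong_induction_on generalizing F with
  | _ n ih =>
    rcases lt_or_ge n 2 with h | h
    · exact mem_fischerSpan_of_mem_harmonics ⟨hF, laplacian_eq_zero_of_lt_two hF h⟩
    · obtain ⟨k, rfl⟩ := Nat.exists_eq_add_of_le' h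
      obtain ⟨R, hR, hRF⟩ := exists_laplacian_eq_of_mem_fischerSpan hd
        (ih k (by omega) (isHomogeneous_laplacian hF))
      -- `R` has the same Laplacian as `F`, so the difference is the harmonic part.
      have hFR : F - R ∈ harmonics d (k + 2) :=
        ⟨hF.sub (isHomogeneous_of_mem_fischerSpan hR), by
          rw [SetLike.mem_coe, LinearMap.mem_ker, map_sub, hRF, sub_self]⟩
      simpa using add_mem (mem_fischerSpan_of_mem_harmonics hFR) hR

/-! ### The orthogonal basis in all degrees -/

/-- The basis polynomial of degree `k + 2j` attached to `Y ∈ ℋ_k`. -/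
noncomputable def sobolevBasis (d k : ℕ) : ℕ → Poly d → Poly d
  | 0, Y => Y
  | m + 1, Y => bubble d k m Y

theorem sobolevU_eq_sobolevBasis (d k j : ℕ) (Y : Poly d) :
    sobolevU d (k + 2 * j) j Y = sobolevBasis d k j Y := by
  rcases j with _ | m
  · simp [sobolevU, sobolevBasis]
  · exact sobolevU_succ_eq_bubble d k m Y

theorem sobolevBasis_mem_orthoPoly {d k : ℕ} (hd : 1 ≤ d) (lam : ℝ) (j : ℕ) {Y : Poly d}
    (hY : Y ∈ harmonics d k) : sobolevBasis d k j Y ∈ orthoPoly d lam (k + 2 * j) := by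
  rcases j with _ | m
  · refine ⟨(isHomogeneous_of_mem_harmonics hY).totalDegree_le, fun Q hQ => ?_⟩
    rw [sobolevInner_comm, sobolevBasis, sobolevInner_harmonic_right hd lam hY,
      sphereMean_mul_harmonic_of_totalDegree_lt hd hY hQ, mul_zero]
  · exact ⟨totalDegree_bubble_le hd m hY,
      fun Q hQ => sobolevInner_bubble_of_totalDegree_lt hd lam m hY hQ⟩

theorem sobolevInner_sobolevBasis_eq_zero {d k l : ℕ} (hd : 1 ≤ d) (lam : ℝ) (i j : ℕ)
    {Y Z : Poly d} (hY : Y ∈ harmonics d k) (hZ : Z ∈ harmonics d l)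
    (h : k + 2 * i = l + 2 * j → sphereMean d (Y * Z) = 0) :
    sobolevInner lam (sobolevBasis d k i Y) (sobolevBasis d l j Z) = 0 := by
  have hA := sobolevBasis_mem_orthoPoly hd lam i hY
  have hB := sobolevBasis_mem_orthoPoly hd lam j hZ
  rcases lt_trichotomy (k + 2 * i) (l + 2 * j) with hlt | heq | hlt
  · rw [sobolevInner_comm]
    exact hB.2 _ (hA.1.trans_lt hlt)
  · have hS := h heq
    rcases i with _ | i <;> rcases j with _ | j
    · rw [sobolevBasis, sobolevBasis, sobolevInner_harmonic_right hd lam hZ, hS, mul_zero]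
    · rw [sobolevInner_comm, sobolevBasis, sobolevBasis, sobolevInner_harmonic_right hd lam hY,
        sphereMean_bubble_mul, mul_zero]
    · rw [sobolevBasis, sobolevBasis, sobolevInner_harmonic_right hd lam hZ,
        sphereMean_bubble_mul, mul_zero]
    · rw [sobolevBasis, sobolevBasis, sobolevInner_bubble_bubble hd lam i j hY hZ, hS, mul_zero,
        zero_mul]
  · exact hA.2 _ (hB.1.trans_lt hlt)

/-- The squared norm of `sobolevBasis d k j Y` for a normalized `Y`. -/
noncomputable def sobolevNorm (d : ℕ) (lam : ℝ) (k j : ℕ) : ℝ :=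
  if j = 0 then lam * k + 1
  else 2 * (j : ℝ) ^ 2 * lam / (2 * j + ((k : ℝ) + ((d : ℝ) - 2) / 2))

theorem sobolevNorm_pos {d : ℕ} (hd : 1 ≤ d) {lam : ℝ} (hlam : 0 < lam) (k j : ℕ) :
    0 < sobolevNorm d lam k j := by
  unfold sobolevNorm
  split_ifs with h
  · positivity
  · have hb := neg_one_lt_param hd k
    have hj : (1 : ℝ) ≤ j := by exact_mod_cast Nat.one_le_iff_ne_zero.2 h
    exact div_pos (by positivity) (by linarith)

theorem sobolevInner_sobolevBasis_self {d k : ℕ} (hd : 1 ≤ d) (lam : ℝ) (j : ℕ) {Y : Poly d}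
    (hY : Y ∈ harmonics d k) (hYY : sphereMean d (Y * Y) = 1) :
    sobolevInner lam (sobolevBasis d k j Y) (sobolevBasis d k j Y) = sobolevNorm d lam k j := by
  rcases j with _ | m
  · rw [sobolevBasis, sobolevInner_harmonic_right hd lam hY, hYY, mul_one, sobolevNorm,
      if_pos rfl]
  · rw [sobolevBasis, sobolevInner_bubble_self hd lam m hY, hYY, mul_one, sobolevNorm,
      if_neg m.succ_ne_zero]
    push_cast
    rfl

/-- One polynomial in each degree, with invertible leading coefficients, spans `ℝ[t]`. -/
theorem span_sobolevSequence_eq_top {b : ℝ} (hb : -1 < b) (W : Submodule ℝ (Polynomial ℝ))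
    (h1 : 1 ∈ W) (hW : ∀ m, (1 - Polynomial.X) * jacobiUnit b m ∈ W) : W = ⊤ := by
  let S : Polynomial.Sequence ℝ :=
    { elems' := fun
        | 0 => 1
        | m + 1 => (1 - Polynomial.X) * jacobiUnit b m
      degree_eq' := fun i => by
        rcases i with _ | m
        · simp
        · have h := natDegree_one_sub_X_mul_jacobiUnit hb m
          refine (Polynomial.degree_eq_iff_natDegree_eq fun h0 => ?_).2 h
          rw [show (1 - Polynomial.X) * jacobiUnit b m = 0 from h0, Polynomial.natDegree_zero] at h
          exact m.succ_ne_zero h.symm }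
  have hS := S.span fun i =>
    isUnit_iff_ne_zero.2 (Polynomial.leadingCoeff_ne_zero.2 (S.ne_zero i))
  rw [eq_top_iff, ← hS, Submodule.span_le]
  rintro _ ⟨_ | m, rfl⟩
  · exact h1
  · exact hW m

section Basis

variable {d : ℕ} (Y : ∀ k : ℕ, Fin (harmonicDim d k) → Poly d)

/-- The basis polynomials of all degrees. -/
noncomputable def sobolevFamily (i : (k : ℕ) × ℕ × Fin (harmonicDim d k)) : Poly d :=
  sobolevBasis d i.1 i.2.1 (Y i.1 i.2.2)

variable {Y}

theorem mem_harmonics_of_isOrthonormalHarmonicBasis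
    (hY : ∀ k, IsOrthonormalHarmonicBasis d k (Y k)) (k : ℕ) (ν : Fin (harmonicDim d k)) :
    Y k ν ∈ harmonics d k := by
  rw [← (hY k).span_eq]
  exact Submodule.subset_span ⟨ν, rfl⟩

theorem sobolevInner_sobolevFamily_self (hd : 1 ≤ d) (lam : ℝ)
    (hY : ∀ k, IsOrthonormalHarmonicBasis d k (Y k))
    (p : (k : ℕ) × ℕ × Fin (harmonicDim d k)) :
    sobolevInner lam (sobolevFamily Y p) (sobolevFamily Y p) = sobolevNorm d lam p.1 p.2.1 := by
  refine sobolevInner_sobolevBasis_self hd lam _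
    (mem_harmonics_of_isOrthonormalHarmonicBasis hY _ _) ?_
  rw [← sphereInner_eq, (hY _).orthonormal, if_pos rfl]

theorem sobolevInner_sobolevFamily_of_ne (hd : 1 ≤ d) (lam : ℝ)
    (hY : ∀ k, IsOrthonormalHarmonicBasis d k (Y k))
    {p q : (k : ℕ) × ℕ × Fin (harmonicDim d k)} (hpq : p ≠ q) :
    sobolevInner lam (sobolevFamily Y p) (sobolevFamily Y q) = 0 := by
  have hmem := mem_harmonics_of_isOrthonormalHarmonicBasis hY
  refine sobolevInner_sobolevBasis_eq_zero hd lam _ _ (hmem _ _) (hmem _ _) fun hdeg => ?_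
  obtain ⟨k, i, μ⟩ := p
  obtain ⟨l, j, ν⟩ := q
  simp only at hdeg ⊢
  by_cases hkl : k = l
  · subst hkl
    obtain rfl : i = j := by omega
    rw [← sphereInner_eq, (hY k).orthonormal, if_neg]
    rintro rfl
    exact hpq rfl
  · exact sphereMean_harmonic_mul_harmonic hd (hmem _ _) (hmem _ _) hkl

theorem span_sobolevFamily (hd : 1 ≤ d) (hY : ∀ k, IsOrthonormalHarmonicBasis d k (Y k)) :
    Submodule.span ℝ (Set.range (sobolevFamily Y)) = ⊤ := by
  set W := Submodule.span ℝ (Set.range (sobolevFamily Y)) with hW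
  have h1 : ∀ k ν (g : Polynomial ℝ), Polynomial.aeval (normSq d) g * Y k ν ∈ W := by
    intro k ν g
    have h : W.comap (LinearMap.mulRight ℝ (Y k ν) ∘ₗ
        (Polynomial.aeval (normSq d)).toLinearMap) = ⊤ := by
      refine span_sobolevSequence_eq_top (neg_one_lt_param hd k) _ ?_ fun m => ?_
      · rw [Submodule.mem_comap]
        refine Submodule.subset_span ⟨⟨k, 0, ν⟩, ?_⟩
        simp [sobolevFamily, sobolevBasis]
      · rw [Submodule.mem_comap]
        exact Submodule.subset_span ⟨⟨k, m + 1, ν⟩, rfl⟩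
    exact (h.symm ▸ Submodule.mem_top : g ∈ W.comap (LinearMap.mulRight ℝ (Y k ν) ∘ₗ
        (Polynomial.aeval (normSq d)).toLinearMap))
  have h2 : ∀ k i, ∀ H ∈ harmonics d k, normSq d ^ i * H ∈ W := by
    intro k i H hH
    have h : harmonics d k ≤ W.comap (LinearMap.mulLeft ℝ (normSq d ^ i)) := by
      rw [← (hY k).span_eq, Submodule.span_le]
      rintro _ ⟨ν, rfl⟩
      simpa using h1 k ν (Polynomial.X ^ i)
    exact h hH
  rw [eq_top_iff]
  intro F _
  rw [← MvPolynomial.sum_homogeneousComponent F]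
  refine Submodule.sum_mem _ fun n _ => ?_
  have h3 : fischerSpan d n ≤ W := by
    refine Submodule.span_le.2 ?_
    rintro _ ⟨i, k, -, H, hH, rfl⟩
    exact h2 k i H hH
  exact h3 (mem_fischerSpan_of_isHomogeneous hd
    (MvPolynomial.homogeneousComponent_isHomogeneous n F))

theorem sobolevInner_linearCombination (hd : 1 ≤ d) (lam : ℝ)
    (hY : ∀ k, IsOrthonormalHarmonicBasis d k (Y k))
    (c : ((k : ℕ) × ℕ × Fin (harmonicDim d k)) →₀ ℝ) (q : (k : ℕ) × ℕ × Fin (harmonicDim d k)) :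
    sobolevInner lam (Finsupp.linearCombination ℝ (sobolevFamily Y) c) (sobolevFamily Y q) =
      c q * sobolevNorm d lam q.1 q.2.1 := by
  let φ : Poly d →ₗ[ℝ] ℝ :=
    { toFun := fun f => sobolevInner lam f (sobolevFamily Y q)
      map_add' := fun f g => sobolevInner_add_left lam f g _
      map_smul' := fun a f => sobolevInner_smul_left lam a f _ }
  change φ _ = _
  rw [Finsupp.apply_linearCombination, Finsupp.linearCombination_apply,
    Finsupp.sum_eq_single q]
  · exact congrArg (c q * ·) (sobolevInner_sobolevFamily_self hd lam hY q)
  · intro p _ hpq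
    have : φ (sobolevFamily Y p) = 0 := sobolevInner_sobolevFamily_of_ne hd lam hY hpq
    simp [this]
  · simp

theorem linearIndependent_sobolevFamily (hd : 1 ≤ d)
    (hY : ∀ k, IsOrthonormalHarmonicBasis d k (Y k)) :
    LinearIndependent ℝ (sobolevFamily Y) := by
  rw [linearIndependent_iff]
  intro c hc
  ext q
  -- The family does not depend on `lam`, so any positive value serves.
  have h := sobolevInner_linearCombination hd 1 hY c q
  rw [hc, ← zero_smul ℝ (0 : Poly d), sobolevInner_smul_left, zero_mul] at h
  exact (mul_eq_zero.1 h.symm).resolve_right (sobolevNorm_pos hd one_pos _ _).ne'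

theorem sobolevFamily_mem_orthoPoly (hd : 1 ≤ d) (lam : ℝ)
    (hY : ∀ k, IsOrthonormalHarmonicBasis d k (Y k))
    (p : (k : ℕ) × ℕ × Fin (harmonicDim d k)) :
    sobolevFamily Y p ∈ orthoPoly d lam (p.1 + 2 * p.2.1) :=
  sobolevBasis_mem_orthoPoly hd lam _ (mem_harmonics_of_isOrthonormalHarmonicBasis hY _ _)

/-- Expand `P` in the full family. Pairing with a member of lower degree gives zero since `P` is
orthogonal to it, and with one of higher degree since that member is orthogonal to `P`; positive
norms then kill those coefficients. -/
theorem orthoPoly_eq_span (hd : 1 ≤ d) {lam : ℝ} (hlam : 0 < lam)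
    (hY : ∀ k, IsOrthonormalHarmonicBasis d k (Y k)) (n : ℕ) :
    orthoPoly d lam n =
      Submodule.span ℝ (sobolevFamily Y '' {p | p.1 + 2 * p.2.1 = n}) := by
  refine le_antisymm (fun P hP => ?_) (Submodule.span_le.2 ?_)
  · obtain ⟨c, rfl⟩ := (Finsupp.mem_span_range_iff_exists_finsupp (R := ℝ)).1
      ((span_sobolevFamily hd hY).symm ▸ Submodule.mem_top :
        P ∈ Submodule.span ℝ (Set.range (sobolevFamily Y)))
    refine Submodule.sum_mem _ fun q hq => ?_
    refine Submodule.smul_mem _ _ (Submodule.subset_span ⟨q, ?_, rfl⟩)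
    by_contra hne
    have h := sobolevInner_linearCombination hd lam hY c q
    have hq' := sobolevFamily_mem_orthoPoly hd lam hY q
    have h0 : sobolevInner lam (Finsupp.linearCombination ℝ (sobolevFamily Y) c)
        (sobolevFamily Y q) = 0 := by
      rcases lt_or_gt_of_ne hne with hlt | hlt
      · exact hP.2 _ (hq'.1.trans_lt hlt)
      · rw [sobolevInner_comm]
        exact hq'.2 _ (hP.1.trans_lt hlt)
    rw [h0] at h
    exact (Finsupp.mem_support_iff.1 hq)
      ((mul_eq_zero.1 h.symm).resolve_right (sobolevNorm_pos hd hlam _ _).ne')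
  · rintro _ ⟨p, rfl, rfl⟩
    exact sobolevFamily_mem_orthoPoly hd lam hY p

end Basis

end BallSobolev

/-! ### Restriction to a fixed degree -/

theorem mainTheorem1 (d : ℕ) (hd : 1 ≤ d) (lam : ℝ) (hlam : 0 < lam)
    (Y : ∀ k : ℕ, Fin (BallSobolev.harmonicDim d k) → BallSobolev.Poly d)
    (hY : ∀ k : ℕ, BallSobolev.IsOrthonormalHarmonicBasis d k (Y k))
    (n : ℕ)
    (U : (j : Fin (n / 2 + 1)) × Fin (BallSobolev.harmonicDim d (n - 2 * (j : ℕ))) →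
      BallSobolev.Poly d)
    (hU : ∀ p, U p = BallSobolev.sobolevU d n p.1 (Y (n - 2 * (p.1 : ℕ)) p.2)) :
    LinearIndependent ℝ U ∧
    Submodule.span ℝ (Set.range U) = BallSobolev.orthoPoly d lam n ∧
    (∀ p q, p ≠ q → BallSobolev.sobolevInner lam (U p) (U q) = 0) ∧
    (∀ p, (p.1 : ℕ) = 0 →
      BallSobolev.sobolevInner lam (U p) (U p) = lam * (n : ℝ) + 1) ∧
    (∀ p, 1 ≤ (p.1 : ℕ) →
      BallSobolev.sobolevInner lam (U p) (U p) =
        2 * ((p.1 : ℕ) : ℝ) ^ 2 * lam / ((n : ℝ) + ((d : ℝ) - 2) / 2)) := by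
  let e : (j : Fin (n / 2 + 1)) × Fin (BallSobolev.harmonicDim d (n - 2 * (j : ℕ))) →
      (k : ℕ) × ℕ × Fin (BallSobolev.harmonicDim d k) :=
    fun p => ⟨n - 2 * (p.1 : ℕ), p.1, p.2⟩
  have hn : ∀ j : Fin (n / 2 + 1), n - 2 * (j : ℕ) + 2 * (j : ℕ) = n := fun j => by omega
  have hUe : U = BallSobolev.sobolevFamily Y ∘ e := by
    funext p
    have h := BallSobolev.sobolevU_eq_sobolevBasis d (n - 2 * (p.1 : ℕ)) p.1
      (Y (n - 2 * (p.1 : ℕ)) p.2)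
    rw [hn] at h
    rw [hU, h]
    rfl
  have he : Function.Injective e := by
    rintro ⟨i, μ⟩ ⟨j, ν⟩ h
    have hij : i = j := by
      have h2 := congrArg (fun x => x.2.1) h
      exact Fin.ext h2
    subst hij
    simpa [e] using h
  have hrange : Set.range e = {p | p.1 + 2 * p.2.1 = n} := by
    ext ⟨k, j, ν⟩
    constructor
    · rintro ⟨p, hp⟩
      rw [← hp]
      exact hn p.1
    · rintro (rfl : k + 2 * j = n)
      have hk : k + 2 * j - 2 * j = k := by omega
      refine ⟨⟨⟨j, by omega⟩, Fin.cast (by rw [hk]) ν⟩, ?_⟩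
      simp only [e]
      -- The type of `ν` depends on the first component, so `k + 2 * j - 2 * j` is generalized to a
      -- variable that can be substituted away.
      have key : ∀ (l : ℕ) (hl : l = k)
          (h' : BallSobolev.harmonicDim d k = BallSobolev.harmonicDim d l),
          (⟨l, j, Fin.cast h' ν⟩ : (k : ℕ) × ℕ × Fin (BallSobolev.harmonicDim d k)) =
            ⟨k, j, ν⟩ := by
        rintro l rfl h'
        rfl
      exact key _ hk _
  have hself : ∀ p, BallSobolev.sobolevInner lam (U p) (U p) =
      BallSobolev.sobolevNorm d lam (n - 2 * (p.1 : ℕ)) p.1 := fun p => by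
    rw [hUe]
    exact BallSobolev.sobolevInner_sobolevFamily_self hd lam hY (e p)
  refine ⟨?_, ?_, fun p q hpq => ?_, fun p hp => ?_, fun p hp => ?_⟩
  · rw [hUe]
    exact (BallSobolev.linearIndependent_sobolevFamily hd hY).comp e he
  · rw [hUe, Set.range_comp, hrange, BallSobolev.orthoPoly_eq_span hd hlam hY n]
  · rw [hUe]
    exact BallSobolev.sobolevInner_sobolevFamily_of_ne hd lam hY (he.ne hpq)
  · rw [hself, hp, BallSobolev.sobolevNorm, if_pos rfl, mul_zero, Nat.sub_zero]
  · rw [hself, BallSobolev.sobolevNorm, if_neg (by omega)]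
    congr 1
    have h : ((n - 2 * (p.1 : ℕ) : ℕ) : ℝ) + 2 * ((p.1 : ℕ) : ℝ) = n := by
      exact_mod_cast hn p.1
    linarith
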